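/- Let $\widetilde{SL}_2$ be the universal covering group of $SL(2,\mathbb R)\cong SU(1,1)$ with the left-invariant metric and the orientation for which $e_j=\tfrac12 f_j$, $j=1,2,3$, is a positive orthonormal basis of the Lie algebra, where $$f_1=\begin{pmatrix}0&1\\1&0\end{pmatrix},\quad f_2=\begin{pmatrix}0&i\\-i&0\end{pmatrix},\quad f_3=\begin{pmatrix}\frac i2&0\\0&-\frac i2\end{pmatrix},$$ so that $[f_1,f_2]=-4f_3$, $[f_1,f_3]=-f_2$, $[f_2,f_3]=f_1$. Let $f:M\to\widetilde{SL}_2$ be a smooth immersion of a closed oriented surface, and regard $M$ as a compact Riemann surface whose holomorphic charts $z=x+iy$ are the positively oriented conformal parameters of the induced metric $e^{2\alpha}dz\,d\bar z$. Put $\partial=\tfrac12(\partial_x-i\partial_y)$, $\bar\partial=\tfrac12(\partial_x+i\partial_y)$, and write $f^{-1}\partial f=Z_1e_1+Z_2e_2+Z_3e_3$. A generating spinor on an open part of a chart is a pair $(\psi_1,\psi_2)$ of $C^1$ complex functions with $$Z_1=\tfrac i2(\bar\psi_2^2+\psi_1^2),\qquad Z_2=\tfrac12(\bar\psi_2^2-\psi_1^2),\qquad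 Z_3=\psi_1\bar\psi_2 .$$ It exists locally and is unique up to a locally constant sign, so $|\psi_1|^2$ and $|\psi_2|^2$ are defined in each chart. Let $H$ be the mean curvature (half the trace of the second fundamental form) with respect to the unit normal $N$ for which $(f_x,f_y,N)$ is positively oriented. In each chart there are unique continuous complex-valued functions $U,V$ such that every generating spinor on an open part of the chart satisfies the Dirac equation $$\partial\psi_2+U\psi_1=0,\qquad -\bar\partial\psi_1+V\psi_2=0,$$ and the energy of the surface is $$E(M)=\int_M UV\,dx\wedge dy=\int_M UV\,\frac{i\,dz\wedge d\bar z}{2}.$$ Then $E(M)$ is real and $$E(M)=\int_M\left[\frac{H^2}{4}\left(|\psi_1|^2+|\psi_2|^2\right)^2-\left(\tfrac12|\psi_1|^2-\tfrac34|\psi_2|^2\right)\left(\tfrac34|\psi_1|^2-\tfrac12|\psi_2|^2\right)\right]\frac{i\,dz\wedge d\bar z}{2}.$$ -/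

import Mathlib

open scoped Manifold ContDiff Matrix

noncomputable section

/-! ### The group `SL̃₂`, the universal covering group of `SL(2, ℝ)`

An element of `SL(2, ℝ)` is an `ℝ`-linear map `w ↦ a * w + b * conj w` of `ℂ` with
`|a|² - |b|² = 1`, equivalently the matrix `(a, b; conj b, conj a)` of `SU(1, 1)`.  Since
`|a| = √(1 + |b|²)`, it is determined by `b` and by `a / |a|`.  Unwinding the
circle of values of `a / |a| = exp (i θ)` gives the universal covering, with global
coordinates `(θ, b) ∈ ℝ × ℂ`. -/

/-- The universal covering of `SL(2, ℝ)`: the pair `(θ, b)` lies above the linear map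
`w ↦ a * w + b * conj w`, where `a = √(1 + |b|²) * exp (i θ)`. -/
def SLTilde : Type := ℝ × ℂ

namespace SLTilde

instance : TopologicalSpace SLTilde := inferInstanceAs (TopologicalSpace (ℝ × ℂ))

instance : ChartedSpace (ℝ × ℂ) SLTilde := inferInstanceAs (ChartedSpace (ℝ × ℂ) (ℝ × ℂ))

instance : IsManifold 𝓘(ℝ, ℝ × ℂ) ω SLTilde :=
  inferInstanceAs (IsManifold 𝓘(ℝ, ℝ × ℂ) ω (ℝ × ℂ))

/-- The lifted angle of `a`. -/
def theta (g : SLTilde) : ℝ := g.1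

/-- The coefficient of `conj w`. -/
def b (g : SLTilde) : ℂ := g.2

/-- The coefficient of `w`. -/
def a (g : SLTilde) : ℂ := (√(1 + ‖g.b‖ ^ 2) : ℝ) * Complex.exp (g.theta * Complex.I)

lemma norm_a (g : SLTilde) : ‖g.a‖ = √(1 + ‖g.b‖ ^ 2) := by
  rw [a, norm_mul, Complex.norm_exp_ofReal_mul_I, mul_one, Complex.norm_real, Real.norm_eq_abs,
    abs_of_nonneg (Real.sqrt_nonneg _)]

lemma norm_a_sq (g : SLTilde) : ‖g.a‖ ^ 2 = 1 + ‖g.b‖ ^ 2 := by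
  rw [norm_a, Real.sq_sqrt (by positivity)]

lemma a_ne_zero (g : SLTilde) : g.a ≠ 0 := by
  intro h
  have := g.norm_a_sq
  rw [h, norm_zero] at this
  nlinarith [sq_nonneg ‖g.b‖]

/-- The quotient of the coefficient of `w` in a composition by the product of the coefficients
of `w` in the factors; it lies in the right half plane. -/
def cocycle (g h : SLTilde) : ℂ := 1 + g.b * (starRingEnd ℂ) h.b / (g.a * h.a)

lemma norm_b_lt (g : SLTilde) : ‖g.b‖ < ‖g.a‖ := by
  have := g.norm_a_sq
  exact lt_of_pow_lt_pow_left₀ 2 (norm_nonneg _) (by linarith)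

lemma cocycle_re_pos (g h : SLTilde) : 0 < (cocycle g h).re := by
  have hn : ‖g.b * (starRingEnd ℂ) h.b / (g.a * h.a)‖ < 1 := by
    rw [norm_div, norm_mul, norm_mul, RCLike.norm_conj, div_lt_one
      (mul_pos (norm_pos_iff.2 g.a_ne_zero) (norm_pos_iff.2 h.a_ne_zero))]
    exact mul_lt_mul'' g.norm_b_lt h.norm_b_lt (norm_nonneg _) (norm_nonneg _)
  have := (abs_le.1 (Complex.abs_re_le_norm (g.b * (starRingEnd ℂ) h.b / (g.a * h.a)))).1
  rw [cocycle, Complex.add_re, Complex.one_re]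
  linarith

/-- The lift of the composition of linear maps. -/
instance : Mul SLTilde :=
  ⟨fun g h => (g.theta + h.theta + (cocycle g h).arg, g.a * h.b + g.b * (starRingEnd ℂ) h.a)⟩

instance : One SLTilde := ⟨((0 : ℝ), (0 : ℂ))⟩

instance : Inv SLTilde := ⟨fun g => (-g.theta, -g.b)⟩

lemma theta_mul (g h : SLTilde) :
    (g * h).theta = g.theta + h.theta + (cocycle g h).arg := rfl

lemma b_mul (g h : SLTilde) : (g * h).b = g.a * h.b + g.b * (starRingEnd ℂ) h.a := rfl

lemma theta_one : (1 : SLTilde).theta = 0 := rfl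

lemma b_one : (1 : SLTilde).b = 0 := rfl

lemma a_one : (1 : SLTilde).a = 1 := by simp [a, b_one, theta_one]

lemma b_inv (g : SLTilde) : (g⁻¹).b = -g.b := rfl

lemma theta_inv (g : SLTilde) : (g⁻¹).theta = -g.theta := rfl

lemma a_eq_norm_mul (g : SLTilde) : g.a = ‖g.a‖ * Complex.exp (g.theta * Complex.I) := by
  rw [norm_a, a]

lemma a_inv (g : SLTilde) : (g⁻¹).a = (starRingEnd ℂ) g.a := by
  simp [a, b_inv, theta_inv, ← Complex.exp_conj]

lemma a_mul_eq (g h : SLTilde) :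
    g.a * h.a * cocycle g h = g.a * h.a + g.b * (starRingEnd ℂ) h.b := by
  have h1 := g.a_ne_zero
  have h2 := h.a_ne_zero
  rw [cocycle]
  field_simp

lemma normSq_identity (x y u v : ℂ) :
    ‖x * v + y * (starRingEnd ℂ) u‖ ^ 2 + (‖x‖ ^ 2 - ‖y‖ ^ 2) * (‖u‖ ^ 2 - ‖v‖ ^ 2) =
      ‖x * u + y * (starRingEnd ℂ) v‖ ^ 2 := by
  simp only [Complex.sq_norm, Complex.normSq_apply, Complex.add_re, Complex.add_im,
    Complex.mul_re, Complex.mul_im, Complex.conj_re, Complex.conj_im]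
  ring

lemma a_mul (g h : SLTilde) : (g * h).a = g.a * h.a + g.b * (starRingEnd ℂ) h.b := by
  have hn : ‖(g * h).a‖ = ‖g.a‖ * ‖h.a‖ * ‖cocycle g h‖ := by
    rw [← norm_mul, ← norm_mul, a_mul_eq]
    refine (pow_left_inj₀ (norm_nonneg _) (norm_nonneg _) two_ne_zero).1 ?_
    rw [← normSq_identity, norm_a_sq, b_mul, g.norm_a_sq, h.norm_a_sq]
    ring
  rw [← a_mul_eq, a_eq_norm_mul (g * h), hn, theta_mul]
  conv_rhs => rw [a_eq_norm_mul g, a_eq_norm_mul h, ← Complex.norm_mul_exp_arg_mul_I (cocycle g h)]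
  push_cast
  rw [add_mul, add_mul, Complex.exp_add, Complex.exp_add]
  ring

lemma ext_of_abs_lt {g h : SLTilde} (hb : g.b = h.b) (ha : g.a = h.a)
    (ht : |g.theta - h.theta| < 2 * Real.pi) : g = h := by
  refine Prod.ext ?_ hb
  have hne : (‖g.a‖ : ℂ) ≠ 0 := by exact_mod_cast norm_ne_zero_iff.2 g.a_ne_zero
  have he : Complex.exp (g.theta * Complex.I) = Complex.exp (h.theta * Complex.I) := by
    have h1 := a_eq_norm_mul g
    have h2 := a_eq_norm_mul h
    rw [← ha] at h2
    exact mul_left_cancel₀ hne (h1.symm.trans h2)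
  obtain ⟨n, hn⟩ := Complex.exp_eq_exp_iff_exists_int.1 he
  have hn' : g.theta = h.theta + n * (2 * Real.pi) := by
    have := congrArg Complex.im hn
    simpa using this
  have hpi := Real.pi_pos
  have hn0 : n = 0 := by
    rw [hn', add_sub_cancel_left, abs_mul, abs_of_pos (by positivity : 0 < 2 * Real.pi)] at ht
    have : |(n : ℝ)| < 1 := by
      by_contra hcon
      nlinarith
    have h3 : |n| < 1 := by exact_mod_cast this
    exact Int.abs_lt_one_iff.1 h3
  rw [hn0] at hn'
  simpa [theta] using hn'

lemma abs_arg_cocycle_lt (g h : SLTilde) : |(cocycle g h).arg| < Real.pi / 2 :=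
  Complex.abs_arg_lt_pi_div_two_iff.2 (Or.inl (cocycle_re_pos g h))

instance : Group SLTilde where
  mul_assoc g h k := by
    refine ext_of_abs_lt ?_ ?_ ?_
    · simp only [b_mul, a_mul, map_add, map_mul, Complex.conj_conj]
      ring
    · simp only [b_mul, a_mul, map_add, map_mul, Complex.conj_conj]
      ring
    · have h1 := abs_lt.1 (abs_arg_cocycle_lt (g * h) k)
      have h2 := abs_lt.1 (abs_arg_cocycle_lt g h)
      have h3 := abs_lt.1 (abs_arg_cocycle_lt g (h * k))
      have h4 := abs_lt.1 (abs_arg_cocycle_lt h k)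
      simp only [theta_mul]
      rw [abs_lt]
      constructor <;> linarith [h1.1, h1.2, h2.1, h2.2, h3.1, h3.2, h4.1, h4.2]
  one_mul g := by
    refine ext_of_abs_lt ?_ ?_ ?_
    · simp [b_mul, a_one, b_one]
    · simp [a_mul, a_one, b_one]
    · simp [theta_mul, theta_one, cocycle, b_one, Real.pi_pos]
  mul_one g := by
    refine ext_of_abs_lt ?_ ?_ ?_
    · simp [b_mul, a_one, b_one]
    · simp [a_mul, a_one, b_one]
    · simp [theta_mul, theta_one, cocycle, b_one, Real.pi_pos]
  inv_mul_cancel g := by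
    have hpi := Real.pi_pos
    refine ext_of_abs_lt ?_ ?_ ?_
    · simp only [b_mul, a_inv, b_inv, b_one]
      ring
    · rw [a_mul, a_inv, b_inv, a_one, neg_mul, Complex.mul_conj, mul_comm, Complex.mul_conj,
        Complex.normSq_eq_norm_sq, Complex.normSq_eq_norm_sq, norm_a_sq]
      push_cast
      ring
    · have h1 := abs_lt.1 (abs_arg_cocycle_lt g⁻¹ g)
      rw [theta_mul, theta_inv, theta_one, abs_lt]
      constructor <;> linarith [h1.1, h1.2]

/-- The covering homomorphism `SL̃₂ → SL(2, ℝ)`: the matrix of `w ↦ a * w + b * conj w` in the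
basis `1, i` of `ℂ`. -/
def proj : SLTilde →* Matrix.SpecialLinearGroup (Fin 2) ℝ where
  toFun g := ⟨!![g.a.re + g.b.re, g.b.im - g.a.im; g.a.im + g.b.im, g.a.re - g.b.re], by
    have h := g.norm_a_sq
    rw [Complex.sq_norm, Complex.sq_norm, Complex.normSq_apply, Complex.normSq_apply] at h
    rw [Matrix.det_fin_two_of]
    linarith⟩
  map_one' := by
    ext i j
    fin_cases i <;> fin_cases j <;> simp [a_one, b_one]
  map_mul' g h := by
    refine Subtype.ext ?_
    change (_ : Matrix (Fin 2) (Fin 2) ℝ) = _ * _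
    ext i j
    fin_cases i <;> fin_cases j <;>
      simp [a_mul, b_mul, Matrix.mul_apply, Fin.sum_univ_two] <;> ring

lemma contDiff_a : ContDiff ℝ ω (fun g : ℝ × ℂ => a g) := by
  have h : (fun g : ℝ × ℂ => a g) = fun g : ℝ × ℂ =>
      ((√(1 + ‖g.2‖ ^ 2) : ℝ) : ℂ) * Complex.exp (g.1 * Complex.I) := rfl
  rw [h]
  have h1 : ContDiff ℝ ω (fun g : ℝ × ℂ => √(1 + ‖g.2‖ ^ 2)) := by
    refine ContDiff.sqrt (contDiff_const.add (contDiff_snd.norm_sq ℝ)) fun x => by positivity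
  have h2 : ContDiff ℝ ω (fun g : ℝ × ℂ => (g.1 : ℂ)) :=
    Complex.ofRealCLM.contDiff.comp contDiff_fst
  exact (Complex.ofRealCLM.contDiff.comp h1).mul (h2.mul contDiff_const).cexp

lemma contDiff_b : ContDiff ℝ ω (fun g : ℝ × ℂ => b g) := contDiff_snd

lemma contDiff_mul : ContDiff ℝ ω (fun p : (ℝ × ℂ) × (ℝ × ℂ) =>
    ((p.1.1 + p.2.1 + (cocycle p.1 p.2).arg, a p.1 * b p.2 + b p.1 * (starRingEnd ℂ) (a p.2)) :
      ℝ × ℂ)) := by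
  have ha1 : ContDiff ℝ ω (fun p : (ℝ × ℂ) × (ℝ × ℂ) => a p.1) := contDiff_a.comp contDiff_fst
  have ha2 : ContDiff ℝ ω (fun p : (ℝ × ℂ) × (ℝ × ℂ) => a p.2) := contDiff_a.comp contDiff_snd
  have hb1 : ContDiff ℝ ω (fun p : (ℝ × ℂ) × (ℝ × ℂ) => b p.1) := contDiff_b.comp contDiff_fst
  have hb2 : ContDiff ℝ ω (fun p : (ℝ × ℂ) × (ℝ × ℂ) => b p.2) := contDiff_b.comp contDiff_snd
  have hc : ContDiff ℝ ω (fun w : ℂ => (starRingEnd ℂ) w) := Complex.conjCLE.contDiff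
  have hco : ContDiff ℝ ω (fun p : (ℝ × ℂ) × (ℝ × ℂ) => cocycle p.1 p.2) := by
    simp only [cocycle, div_eq_mul_inv]
    exact contDiff_const.add ((hb1.mul (hc.comp hb2)).mul ((ha1.mul ha2).inv
      fun p => mul_ne_zero (a_ne_zero _) (a_ne_zero _)))
  have harg : ContDiff ℝ ω (fun p : (ℝ × ℂ) × (ℝ × ℂ) => (cocycle p.1 p.2).arg) := by
    have : (fun p : (ℝ × ℂ) × (ℝ × ℂ) => (cocycle p.1 p.2).arg) =
        fun p => Complex.imCLM (Complex.log (cocycle p.1 p.2)) := by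
      ext p
      simp [Complex.log_im]
    rw [this]
    refine Complex.imCLM.contDiff.comp (contDiff_iff_contDiffAt.2 fun p => ?_)
    exact ((Complex.contDiffAt_log (Or.inl (cocycle_re_pos _ _))).restrict_scalars ℝ).comp p
      hco.contDiffAt
  exact (((contDiff_fst.comp contDiff_fst).add (contDiff_fst.comp contDiff_snd)).add harg).prodMk
    ((ha1.mul hb2).add (hb1.mul (hc.comp ha2)))

instance : LieGroup 𝓘(ℝ, ℝ × ℂ) ω SLTilde where
  contMDiff_mul := by
    have h := contDiff_mul.contMDiff
    rw [modelWithCornersSelf_prod, ← chartedSpaceSelf_prod] at h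
    exact h
  contMDiff_inv := by
    have h : ContDiff ℝ ω (fun g : ℝ × ℂ => (-g.1, -g.2)) := contDiff_fst.neg.prodMk contDiff_snd.neg
    exact h.contMDiff

instance : SimplyConnectedSpace SLTilde :=
  inferInstanceAs (SimplyConnectedSpace (ℝ × ℂ))


instance : IsTopologicalGroup SLTilde := topologicalGroup_of_lieGroup 𝓘(ℝ, ℝ × ℂ) ω

/-- The coefficient `a` of an element of `SL(2, ℝ)`. -/
def coeffA (A : Matrix.SpecialLinearGroup (Fin 2) ℝ) : ℂ :=
  ⟨(A.1 0 0 + A.1 1 1) / 2, (A.1 1 0 - A.1 0 1) / 2⟩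

/-- The coefficient `b` of an element of `SL(2, ℝ)`. -/
def coeffB (A : Matrix.SpecialLinearGroup (Fin 2) ℝ) : ℂ :=
  ⟨(A.1 0 0 - A.1 1 1) / 2, (A.1 1 0 + A.1 0 1) / 2⟩

lemma norm_coeffA (A : Matrix.SpecialLinearGroup (Fin 2) ℝ) :
    ‖coeffA A‖ = √(1 + ‖coeffB A‖ ^ 2) := by
  have h := A.2
  rw [Matrix.det_fin_two] at h
  rw [eq_comm, Real.sqrt_eq_iff_mul_self_eq (by positivity) (norm_nonneg _), ← sq,
    Complex.sq_norm, Complex.sq_norm, Complex.normSq_apply, Complex.normSq_apply]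
  simp only [coeffA, coeffB]
  linear_combination -h

lemma norm_coeffA_ne_zero (A : Matrix.SpecialLinearGroup (Fin 2) ℝ) : ‖coeffA A‖ ≠ 0 := by
  rw [norm_coeffA]
  positivity

lemma continuous_coeffA : Continuous coeffA := by
  have h : coeffA = fun A => (((A.1 0 0 + A.1 1 1) / 2 : ℝ) : ℂ) +
      (((A.1 1 0 - A.1 0 1) / 2 : ℝ) : ℂ) * Complex.I := by
    ext A
    exact (Complex.mk_eq_add_mul_I _ _)
  rw [h]
  fun_prop

lemma continuous_coeffB : Continuous coeffB := by
  have h : coeffB = fun A => (((A.1 0 0 - A.1 1 1) / 2 : ℝ) : ℂ) +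
      (((A.1 1 0 + A.1 0 1) / 2 : ℝ) : ℂ) * Complex.I := by
    ext A
    exact (Complex.mk_eq_add_mul_I _ _)
  rw [h]
  fun_prop

lemma coeffA_proj (g : SLTilde) : coeffA (proj g) = g.a := by
  apply Complex.ext
  · change (g.a.re + g.b.re + (g.a.re - g.b.re)) / 2 = g.a.re
    ring
  · change (g.a.im + g.b.im - (g.b.im - g.a.im)) / 2 = g.a.im
    ring

lemma coeffB_proj (g : SLTilde) : coeffB (proj g) = g.b := by
  apply Complex.ext
  · change (g.a.re + g.b.re - (g.a.re - g.b.re)) / 2 = g.b.re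
    ring
  · change (g.a.im + g.b.im + (g.b.im - g.a.im)) / 2 = g.b.im
    ring

/-- The element of `SL(2, ℝ)` with given `a / |a|` and `b`. -/
def polarFun (u : Circle) (b : ℂ) : Matrix.SpecialLinearGroup (Fin 2) ℝ :=
  ⟨!![√(1 + ‖b‖ ^ 2) * (u : ℂ).re + b.re, b.im - √(1 + ‖b‖ ^ 2) * (u : ℂ).im;
      √(1 + ‖b‖ ^ 2) * (u : ℂ).im + b.im, √(1 + ‖b‖ ^ 2) * (u : ℂ).re - b.re], by
    have h1 : (u : ℂ).re * (u : ℂ).re + (u : ℂ).im * (u : ℂ).im = 1 := by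
      rw [← Complex.normSq_apply, Circle.normSq_coe]
    have h2 : √(1 + ‖b‖ ^ 2) ^ 2 = 1 + (b.re * b.re + b.im * b.im) := by
      rw [Real.sq_sqrt (by positivity), Complex.sq_norm, Complex.normSq_apply]
    rw [Matrix.det_fin_two_of]
    linear_combination √(1 + ‖b‖ ^ 2) ^ 2 * h1 + h2⟩

lemma coeffA_polarFun (u : Circle) (b : ℂ) :
    coeffA (polarFun u b) = (√(1 + ‖b‖ ^ 2) : ℝ) * (u : ℂ) := by
  apply Complex.ext
  · rw [Complex.re_ofReal_mul]; simp [coeffA, polarFun]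
  · rw [Complex.im_ofReal_mul]; simp [coeffA, polarFun]; ring

lemma coeffB_polarFun (u : Circle) (b : ℂ) : coeffB (polarFun u b) = b := by
  apply Complex.ext
  · simp [coeffB, polarFun]
  · simp [coeffB, polarFun]; ring

/-- The coordinates `(a / |a|, b)` on `SL(2, ℝ)`. -/
def polar : Circle × ℂ ≃ₜ Matrix.SpecialLinearGroup (Fin 2) ℝ where
  toFun p := polarFun p.1 p.2
  invFun A := (⟨coeffA A / ‖coeffA A‖, by
    rw [Submonoid.unitSphere, Submonoid.mem_mk, Subsemigroup.mem_mk, mem_sphere_zero_iff_norm,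
      norm_div, Complex.norm_real, norm_norm, div_self (norm_coeffA_ne_zero A)]⟩, coeffB A)
  left_inv p := by
    refine Prod.ext (Circle.ext ?_) (coeffB_polarFun _ _)
    have hpos : (√(1 + ‖p.2‖ ^ 2) : ℝ) ≠ 0 := by positivity
    have hpos' : ((√(1 + ‖p.2‖ ^ 2) : ℝ) : ℂ) ≠ 0 := by exact_mod_cast hpos
    change coeffA (polarFun p.1 p.2) / (‖coeffA (polarFun p.1 p.2)‖ : ℂ) = p.1
    rw [norm_coeffA, coeffA_polarFun, coeffB_polarFun, mul_div_cancel_left₀ _ hpos']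
  right_inv A := by
    have hn := norm_coeffA_ne_zero A
    have h1 : ‖coeffA A‖ * (coeffA A / (‖coeffA A‖ : ℂ)).re = (coeffA A).re := by
      rw [Complex.div_ofReal_re]; field_simp
    have h2 : ‖coeffA A‖ * (coeffA A / (‖coeffA A‖ : ℂ)).im = (coeffA A).im := by
      rw [Complex.div_ofReal_im]; field_simp
    refine Subtype.ext ?_
    change !![_, _; _, _] = A.1
    simp only [← norm_coeffA]
    rw [h1, h2]
    ext i j
    fin_cases i <;> fin_cases j <;> simp [coeffA, coeffB] <;> ring
  continuous_toFun := by
    refine Continuous.subtype_mk (continuous_matrix fun i j => ?_) _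
    fin_cases i <;> fin_cases j <;> simp <;> fun_prop
  continuous_invFun := by
    refine Continuous.prodMk (Continuous.subtype_mk ?_ _) continuous_coeffB
    exact continuous_coeffA.div (Complex.continuous_ofReal.comp continuous_coeffA.norm)
      fun A => by exact_mod_cast norm_coeffA_ne_zero A

lemma proj_eq_polar (g : SLTilde) : proj g = polar (Circle.exp g.theta, g.b) := by
  have ha : g.a.re = √(1 + ‖g.b‖ ^ 2) * ((Circle.exp g.theta : Circle) : ℂ).re ∧
      g.a.im = √(1 + ‖g.b‖ ^ 2) * ((Circle.exp g.theta : Circle) : ℂ).im := by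
    rw [Circle.coe_exp, a, Complex.re_ofReal_mul, Complex.im_ofReal_mul]
    exact ⟨rfl, rfl⟩
  refine Subtype.ext ?_
  change !![g.a.re + g.b.re, g.b.im - g.a.im; g.a.im + g.b.im, g.a.re - g.b.re] = !![_, _; _, _]
  rw [ha.1, ha.2]

/-- `SL̃₂` is a covering of `SL(2, ℝ)`, the universal one since `SL̃₂` is simply connected. -/
theorem isCoveringMap_proj : IsCoveringMap proj := by
  have hq : Topology.IsQuotientMap proj := by
    have h1 : IsOpenQuotientMap (Prod.map Circle.exp (id : ℂ → ℂ)) :=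
      Circle.isAddQuotientCoveringMap_exp.isOpenQuotientMap.prodMap IsOpenQuotientMap.id
    have h2 := polar.isQuotientMap.comp h1.isQuotientMap
    have h3 : (proj : SLTilde → _) = fun g => polar (Prod.map Circle.exp (id : ℂ → ℂ) g) := by
      ext1 g
      exact proj_eq_polar g
    rw [h3]
    exact h2
  refine (hq.isQuotientCoveringMap_of_isDiscrete_ker_monoidHom ?_).isCoveringMap
  refine isDiscrete_iff_forall_mem_exists_isOpen.2 fun g hg =>
    ⟨{h | |theta h - theta g| < 2 * Real.pi}, ?_, ?_⟩
  · have hc : Continuous theta := continuous_fst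
    exact isOpen_lt (hc.sub continuous_const).abs continuous_const
  · refine Set.Subset.antisymm (fun h hh => ?_) (fun h hh => ?_)
    · have he : proj h = proj g := (MonoidHom.mem_ker.1 hh.2).trans (MonoidHom.mem_ker.1 hg).symm
      refine ext_of_abs_lt ?_ ?_ hh.1
      · rw [← coeffB_proj, he, coeffB_proj]
      · rw [← coeffA_proj, he, coeffA_proj]
    · rw [Set.mem_singleton_iff.1 hh]
      exact ⟨by simp [Real.pi_pos], hg⟩

/-! ### The Lie algebra, the left-invariant metric and its Levi-Civita connection -/

/-- The basis `e₁, e₂, e₃` (numbered from `0`) of the Lie algebra `sl(2, ℝ)`.  The elements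
`f_j = 2 e_j` are the linear maps `w ↦ conj w`, `w ↦ i * conj w`, `w ↦ (i / 2) * w`, and satisfy
`[f₁, f₂] = -4 f₃`, `[f₁, f₃] = -f₂`, `[f₂, f₃] = f₁`. -/
def basis : Fin 3 → Matrix (Fin 2) (Fin 2) ℝ :=
  ![!![1 / 2, 0; 0, -(1 / 2)], !![0, 1 / 2; 1 / 2, 0], !![0, -(1 / 4); 1 / 4, 0]]

/-- The coordinates of a traceless matrix in the basis `e₁, e₂, e₃`. -/
def coord (X : Matrix (Fin 2) (Fin 2) ℝ) : Fin 3 → ℝ :=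
  ![X 0 0 - X 1 1, X 0 1 + X 1 0, 2 * (X 1 0 - X 0 1)]

lemma sum_coord_smul_basis (X : Matrix (Fin 2) (Fin 2) ℝ) (hX : X.trace = 0) :
    ∑ k, coord X k • basis k = X := by
  have h : X 0 0 + X 1 1 = 0 := by simpa [Matrix.trace_fin_two] using hX
  ext i j
  fin_cases i <;> fin_cases j <;>
    simp [Fin.sum_univ_three, coord, basis] <;> linarith

lemma coord_basis (j : Fin 3) : coord (basis j) = Pi.single j 1 := by
  ext k
  fin_cases j <;> fin_cases k <;> simp [coord, basis] <;> norm_num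

/-- `α_{ijk} = ⟨[e_i, e_j], e_k⟩` for the inner product in which `e₁, e₂, e₃` is orthonormal. -/
def structureConst (i j k : Fin 3) : ℝ :=
  coord (basis i * basis j - basis j * basis i) k

/-- `⟨∇_{e_k} e_j, e_i⟩` for the Levi-Civita connection of the left-invariant metric in which
the left-invariant frame `e₁, e₂, e₃` is orthonormal. -/
def connection (k j i : Fin 3) : ℝ :=
  (structureConst k j i + structureConst i k j + structureConst i j k) / 2

/-! ### Maps from a domain of `ℂ` into `SL̃₂`

Tangent vectors of `SL̃₂` are expressed through their coordinates in the left-invariant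
orthonormal frame `e₁, e₂, e₃`; the metric is then the standard dot product. -/

/-- The coordinates in the frame `e₁, e₂, e₃` of the left translate to the unit
`F⁻¹ dF(u)` of the derivative of `F` at `z` along `u`. -/
def velocity (F : ℂ → SLTilde) (z u : ℂ) : Fin 3 → ℝ :=
  coord (((proj (F z))⁻¹ : Matrix.SpecialLinearGroup (Fin 2) ℝ).1 *
    Matrix.of fun i j => fderiv ℝ (fun w => (proj (F w)).1 i j) z u)

/-- The velocity is invariant under left translations, hence so is the metric. -/
lemma velocity_mul_left (g : SLTilde) (F : ℂ → SLTilde) (z u : ℂ)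
    (hF : ∀ i j, DifferentiableAt ℝ (fun w => (proj (F w)).1 i j) z) :
    velocity (fun w => g * F w) z u = velocity F z u := by
  have h : (Matrix.of fun i j => fderiv ℝ (fun w => (proj (g * F w)).1 i j) z u) =
      (proj g).1 * Matrix.of fun i j => fderiv ℝ (fun w => (proj (F w)).1 i j) z u := by
    ext i j
    have he : (fun w => (proj (g * F w)).1 i j) =
        fun w => ∑ k, (proj g).1 i k * (proj (F w)).1 k j := by
      ext w
      rw [map_mul]
      exact Matrix.mul_apply
    rw [Matrix.of_apply, he, fderiv_fun_sum fun k _ => (hF k j).const_mul _]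
    simp [Matrix.mul_apply, fderiv_const_mul (hF _ _)]
  rw [velocity, velocity, h, ← Matrix.mul_assoc, map_mul, mul_inv_rev]
  congr 2
  change ((proj (F z))⁻¹ * (proj g)⁻¹ * proj g).1 = _
  rw [inv_mul_cancel_right]

/-- The conformal factor `e^{2α}` of the induced metric `e^{2α} dz dz̄`. -/
def conformalFactor (F : ℂ → SLTilde) (z : ℂ) : ℝ := velocity F z 1 ⬝ᵥ velocity F z 1

/-- The covariant derivative along `u` of the vector field `∑ Y^i e_i` along `F`. -/
def covDeriv (F : ℂ → SLTilde) (Y : ℂ → Fin 3 → ℝ) (z u : ℂ) : Fin 3 → ℝ := fun i =>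
  fderiv ℝ (fun w => Y w i) z u + ∑ k, ∑ j, velocity F z u k * Y z j * connection k j i

/-- The left translate `F⁻¹(N)` of the unit normal `N` of a conformal immersion, the orientation
of `SL̃₂` being the one in which `e₁, e₂, e₃` is positive. -/
def normal (F : ℂ → SLTilde) (z : ℂ) : Fin 3 → ℝ :=
  (conformalFactor F z)⁻¹ • (velocity F z 1 ⨯₃ velocity F z Complex.I)

/-- The mean curvature (half of the trace of the second fundamental form with respect to the
normal `N`) of a conformal immersion. -/
def meanCurvature (F : ℂ → SLTilde) (z : ℂ) : ℝ :=
  ((covDeriv F (fun w => velocity F w 1) z 1 +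
    covDeriv F (fun w => velocity F w Complex.I) z Complex.I) ⬝ᵥ normal F z) /
    (2 * conformalFactor F z)

/-- The coefficients `Z_k` in `F⁻¹ ∂F = ∑ Z_k e_k`, where `∂ = (∂_x - i ∂_y) / 2`. -/
def zCoeff (F : ℂ → SLTilde) (z : ℂ) (k : Fin 3) : ℂ :=
  ((velocity F z 1 k : ℂ) - Complex.I * (velocity F z Complex.I k : ℂ)) / 2

/-- `(ψ₁, ψ₂)` parametrizes the isotropic vector `Z`. -/
def IsSpinor (Z : Fin 3 → ℂ) (ψ : ℂ × ℂ) : Prop :=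
  Z 0 = Complex.I / 2 * ((starRingEnd ℂ) ψ.2 ^ 2 + ψ.1 ^ 2) ∧
  Z 1 = 1 / 2 * ((starRingEnd ℂ) ψ.2 ^ 2 - ψ.1 ^ 2) ∧
  Z 2 = ψ.1 * (starRingEnd ℂ) ψ.2

/-- A value at `z` of the generating spinor of `F`; for a conformal immersion it exists and is
unique up to a common sign of `ψ₁` and `ψ₂`. -/
def spinor (F : ℂ → SLTilde) (z : ℂ) : ℂ × ℂ := Classical.epsilon (IsSpinor (zCoeff F z))

/-- `∂ = (∂_x - i ∂_y) / 2`. -/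
def wirtinger (h : ℂ → ℂ) (z : ℂ) : ℂ :=
  (fderiv ℝ h z 1 - Complex.I * fderiv ℝ h z Complex.I) / 2

/-- `∂̄ = (∂_x + i ∂_y) / 2`. -/
def wirtingerBar (h : ℂ → ℂ) (z : ℂ) : ℂ :=
  (fderiv ℝ h z 1 + Complex.I * fderiv ℝ h z Complex.I) / 2

/-- `U` and `V` are the potentials on `D` of the Dirac operator of `F`: they are continuous, and
every local generating spinor `ψ` of `F` satisfies the Dirac equation
`∂ψ₂ + U ψ₁ = 0`, `-∂̄ψ₁ + V ψ₂ = 0`. -/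
def IsDiracPotential (F : ℂ → SLTilde) (D : Set ℂ) (U V : ℂ → ℂ) : Prop :=
  ContinuousOn U D ∧ ContinuousOn V D ∧
  ∀ Ω : Set ℂ, IsOpen Ω → Ω ⊆ D → ∀ ψ₁ ψ₂ : ℂ → ℂ,
    ContDiffOn ℝ 1 ψ₁ Ω → ContDiffOn ℝ 1 ψ₂ Ω →
    (∀ z ∈ Ω, IsSpinor (zCoeff F z) (ψ₁ z, ψ₂ z)) →
    ∀ z ∈ Ω, wirtinger ψ₂ z + U z * ψ₁ z = 0 ∧ -wirtingerBar ψ₁ z + V z * ψ₂ z = 0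

end SLTilde

/-! ### Closed oriented surfaces -/

/-- A Riemann surface is a smooth real surface. -/
theorem isManifold_real_of_complex (M : Type*) [TopologicalSpace M] [ChartedSpace ℂ M]
    [IsManifold 𝓘(ℂ) ω M] : IsManifold 𝓘(ℝ, ℂ) ∞ M := by
  refine isManifold_of_contDiffOn 𝓘(ℝ, ℂ) ∞ M fun e e' he he' => ?_
  have h := (contDiffGroupoid ω 𝓘(ℂ)).compatible he he'
  have h1 := ((contDiffGroupoid ω 𝓘(ℂ)).mem_iff_of_eqOnSource (Setoid.refl _)).1 h
  rw [contDiffGroupoid, mem_groupoid_of_pregroupoid] at h1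
  have h2 : ContDiffOn ℂ ω (e.symm.trans e') (e.symm.trans e').source := by
    simpa [contDiffPregroupoid] using h1.1
  simpa using (h2.restrict_scalars ℝ).of_le le_top

/-- A smooth partition of unity on a closed Riemann surface subordinate to its charts. -/
def chartPartition (M : Type*) [TopologicalSpace M] [T2Space M] [CompactSpace M]
    [ChartedSpace ℂ M] [IsManifold 𝓘(ℂ) ω M] :
    SmoothPartitionOfUnity M 𝓘(ℝ, ℂ) M Set.univ :=
  haveI := isManifold_real_of_complex M
  (SmoothPartitionOfUnity.exists_isSubordinate_chartAt_source 𝓘(ℝ, ℂ) M).choose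

theorem chartPartition_isSubordinate (M : Type*) [TopologicalSpace M] [T2Space M] [CompactSpace M]
    [ChartedSpace ℂ M] [IsManifold 𝓘(ℂ) ω M] :
    (chartPartition M).IsSubordinate fun p => (chartAt ℂ p).source :=
  haveI := isManifold_real_of_complex M
  (SmoothPartitionOfUnity.exists_isSubordinate_chartAt_source 𝓘(ℝ, ℂ) M).choose_spec

/-- The integral over a closed Riemann surface `M` of the `2`-form which is
`h e z dx ∧ dy = h e z (i dz ∧ dz̄ / 2)` in the chart `e` with coordinate `z = x + i y`. -/
def surfaceIntegral {M : Type*} [TopologicalSpace M] [T2Space M] [CompactSpace M]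
    [ChartedSpace ℂ M] [IsManifold 𝓘(ℂ) ω M] {E : Type*} [NormedAddCommGroup E] [NormedSpace ℝ E]
    (h : OpenPartialHomeomorph M ℂ → ℂ → E) : E :=
  ∑ᶠ p : M, ∫ z in (chartAt ℂ p).target,
    chartPartition M p ((chartAt ℂ p).symm z) • h (chartAt ℂ p) z

/-- `f` is a smooth immersion, and the charts of `M` are conformal parameters for the
metric induced by `f`. -/
structure IsConformalImmersion {M : Type*} [TopologicalSpace M] [ChartedSpace ℂ M]
    (f : M → SLTilde) : Prop where
  smooth : ContMDiff 𝓘(ℝ, ℂ) 𝓘(ℝ, ℝ × ℂ) ∞ f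
  immersion : ∀ p : M, Function.Injective (mfderiv 𝓘(ℝ, ℂ) 𝓘(ℝ, ℝ × ℂ) f p)
  conformal : ∀ e ∈ atlas ℂ M, ∀ z ∈ e.target,
    SLTilde.velocity (f ∘ e.symm) z 1 ⬝ᵥ SLTilde.velocity (f ∘ e.symm) z 1 =
      SLTilde.velocity (f ∘ e.symm) z Complex.I ⬝ᵥ SLTilde.velocity (f ∘ e.symm) z Complex.I ∧
    SLTilde.velocity (f ∘ e.symm) z 1 ⬝ᵥ SLTilde.velocity (f ∘ e.symm) z Complex.I = 0

/-- The potentials `(U, V)` of the Dirac operator of a surface in the chart `e`. -/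
def diracPotentials {M : Type*} [TopologicalSpace M] (f : M → SLTilde)
    (e : OpenPartialHomeomorph M ℂ) : (ℂ → ℂ) × (ℂ → ℂ) :=
  Classical.epsilon fun P : (ℂ → ℂ) × (ℂ → ℂ) =>
    SLTilde.IsDiracPotential (f ∘ e.symm) e.target P.1 P.2

/-- The energy `E(M) = ∫_M U V dx ∧ dy` of a closed surface. -/
def energy {M : Type*} [TopologicalSpace M] [T2Space M] [CompactSpace M]
    [ChartedSpace ℂ M] [IsManifold 𝓘(ℂ) ω M] (f : M → SLTilde) : ℂ :=
  surfaceIntegral fun (e : OpenPartialHomeomorph M ℂ) z =>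
    (diracPotentials f e).1 z * (diracPotentials f e).2 z

end

/-! The potentials can be computed. The Maurer-Cartan equation gives the antisymmetric part of the
derivatives of `f⁻¹ df`, and conformality makes the trace of the second fundamental form normal to
the surface, which gives the symmetric part through `H`. Together they determine `∂̄Z`
(`ConformalOn.wirtingerBar_zCoeff_eq`). Since `Z` is quadratic in the spinor, the product rule turns
this into the Dirac equation with `U = A + iB`, `V = A + iC`, where `A = (H/2)(|ψ₁|² + |ψ₂|²)`, `B =
½|ψ₁|² - ¾|ψ₂|²`, `C = ¾|ψ₁|² - ½|ψ₂|²`. These are the only continuous potentials: `U` could be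
altered only on an open set where `ψ₁ = 0`, but there the second equation forces `Vψ₂ = 0`, while
`Im V = -½|ψ₂|² ≠ 0`; the case of `V` is symmetric.

Hence `UV = A² - BC + iA(B + C)`. The real part is the asserted integrand. The imaginary part is
`(5/8) H (|ψ₁|⁴ - |ψ₂|⁴)`, which is `-5/16` times the planar divergence of the `e₃`-component of
`f⁻¹ df` (`ConformalOn.potential_mul`). It is a pure divergence because `e₃` is a Killing field, so
the connection contributes nothing to that component.

It remains to see that this divergence integrates to zero over the closed surface
(`surfaceIntegral_divVertical`). This is Stokes' theorem, proved with the partition of unity: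
integration by parts in a chart moves the derivative onto the cutoff, conformal invariance moves the
resulting integrals between charts, and the differentials of the cutoffs add up to zero. -/

noncomputable section

namespace SLTilde

/-! ### Calculus of maps into the group, up to the Maurer-Cartan equation. -/

/-- The entries of the matrix of `F`. -/
def entry (F : ℂ → SLTilde) (i j : Fin 2) (w : ℂ) : ℝ := (proj (F w)).1 i j

lemma entry_det (F : ℂ → SLTilde) (z : ℂ) :
    entry F 0 0 z * entry F 1 1 z - entry F 0 1 z * entry F 1 0 z = 1 := by
  have := (proj (F z)).2
  rwa [Matrix.det_fin_two] at this

/-- The inverse of a matrix of determinant one is its adjugate, so the velocity is polynomial in the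
entries and their derivatives. With the two lemmas that follow, this reduces the local theory to
polynomial identities. -/
lemma velocity_zero_eq (F : ℂ → SLTilde) (z u : ℂ) : velocity F z u 0 =
    (entry F 1 1 z * fderiv ℝ (entry F 0 0) z u - entry F 0 1 z * fderiv ℝ (entry F 1 0) z u) -
    (entry F 0 0 z * fderiv ℝ (entry F 1 1) z u - entry F 1 0 z * fderiv ℝ (entry F 0 1) z u) := by
  simp only [velocity, Matrix.SpecialLinearGroup.coe_inv, Matrix.adjugate_fin_two, coord,
    Matrix.mul_apply, Fin.sum_univ_two]
  simp
  change _ * fderiv ℝ (entry F 0 0) z u + -(_ * fderiv ℝ (entry F 1 0) z u) -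
    (-(_ * fderiv ℝ (entry F 0 1) z u) + _ * fderiv ℝ (entry F 1 1) z u) = _
  simp only [entry]
  ring

lemma velocity_one_eq (F : ℂ → SLTilde) (z u : ℂ) : velocity F z u 1 =
    (entry F 1 1 z * fderiv ℝ (entry F 0 1) z u - entry F 0 1 z * fderiv ℝ (entry F 1 1) z u) +
    (entry F 0 0 z * fderiv ℝ (entry F 1 0) z u - entry F 1 0 z * fderiv ℝ (entry F 0 0) z u) := by
  simp only [velocity, Matrix.SpecialLinearGroup.coe_inv, Matrix.adjugate_fin_two, coord,
    Matrix.mul_apply, Fin.sum_univ_two]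
  simp
  change _ * fderiv ℝ (entry F 0 1) z u + -(_ * fderiv ℝ (entry F 1 1) z u) +
    (-(_ * fderiv ℝ (entry F 0 0) z u) + _ * fderiv ℝ (entry F 1 0) z u) = _
  simp only [entry]
  ring

lemma velocity_two_eq (F : ℂ → SLTilde) (z u : ℂ) : velocity F z u 2 =
    2 * ((entry F 0 0 z * fderiv ℝ (entry F 1 0) z u -
      entry F 1 0 z * fderiv ℝ (entry F 0 0) z u) -
    (entry F 1 1 z * fderiv ℝ (entry F 0 1) z u -
      entry F 0 1 z * fderiv ℝ (entry F 1 1) z u)) := by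
  simp only [velocity, Matrix.SpecialLinearGroup.coe_inv, Matrix.adjugate_fin_two, coord,
    Matrix.mul_apply, Fin.sum_univ_two]
  simp
  change (-(_ * fderiv ℝ (entry F 0 0) z u) + _ * fderiv ℝ (entry F 1 0) z u) -
    (_ * fderiv ℝ (entry F 0 1) z u + -(_ * fderiv ℝ (entry F 1 1) z u)) = _
  simp only [entry]
  ring

/-- The matrix of `F` is a smooth function on the open set `D`. -/
structure SmoothOn (F : ℂ → SLTilde) (D : Set ℂ) : Prop where
  isOpen : IsOpen D
  contDiffOn : ∀ i j, ContDiffOn ℝ ∞ (entry F i j) D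

variable {F : ℂ → SLTilde} {D : Set ℂ} {z : ℂ}

lemma SmoothOn.contDiffAt (h : SmoothOn F D) (hz : z ∈ D) (i j : Fin 2) :
    ContDiffAt ℝ ∞ (entry F i j) z :=
  (h.contDiffOn i j).contDiffAt (h.isOpen.mem_nhds hz)

lemma SmoothOn.contDiffAt_fderiv (h : SmoothOn F D) (hz : z ∈ D) (i j : Fin 2) (u : ℂ) :
    ContDiffAt ℝ ∞ (fun w => fderiv ℝ (entry F i j) w u) z :=
  ((h.contDiffAt hz i j).fderiv_right (m := ∞) (by simp)).clm_apply contDiffAt_const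

lemma SmoothOn.contDiffAt_velocity (h : SmoothOn F D) (hz : z ∈ D) (u : ℂ) (k : Fin 3) :
    ContDiffAt ℝ ∞ (fun w => velocity F w u k) z := by
  have h0 := h.contDiffAt hz
  have h1 := fun i j => h.contDiffAt_fderiv hz i j u
  fin_cases k
  · simp only [Fin.zero_eta, velocity_zero_eq]
    exact (((h0 1 1).mul (h1 0 0)).sub ((h0 0 1).mul (h1 1 0))).sub
      (((h0 0 0).mul (h1 1 1)).sub ((h0 1 0).mul (h1 0 1)))
  · simp only [Fin.mk_one, velocity_one_eq]
    exact (((h0 1 1).mul (h1 0 1)).sub ((h0 0 1).mul (h1 1 1))).add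
      (((h0 0 0).mul (h1 1 0)).sub ((h0 1 0).mul (h1 0 0)))
  · simp only [Fin.reduceFinMk, velocity_two_eq]
    exact contDiffAt_const.mul ((((h0 0 0).mul (h1 1 0)).sub ((h0 1 0).mul (h1 0 0))).sub
      (((h0 1 1).mul (h1 0 1)).sub ((h0 0 1).mul (h1 1 1))))

lemma SmoothOn.differentiableAt_velocity (h : SmoothOn F D) (hz : z ∈ D) (u : ℂ) (k : Fin 3) :
    DifferentiableAt ℝ (fun w => velocity F w u k) z :=
  (h.contDiffAt_velocity hz u k).differentiableAt (by simp)

lemma fderiv_apply_eq (l : ℂ →L[ℝ] ℝ) (u : ℂ) : l u = u.re * l 1 + u.im * l Complex.I := by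
  conv_lhs => rw [← Complex.re_add_im u, map_add, ← Complex.real_smul, ← mul_one (u.re : ℂ),
    ← Complex.real_smul, map_smul, map_smul, smul_eq_mul, smul_eq_mul]

lemma velocity_eq (F : ℂ → SLTilde) (z u : ℂ) (k : Fin 3) :
    velocity F z u k = u.re * velocity F z 1 k + u.im * velocity F z Complex.I k := by
  fin_cases k
  · simp only [Fin.zero_eta, velocity_zero_eq, fderiv_apply_eq _ u]
    ring
  · simp only [Fin.mk_one, velocity_one_eq, fderiv_apply_eq _ u]
    ring
  · simp only [Fin.reduceFinMk, velocity_two_eq, fderiv_apply_eq _ u]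
    ring

lemma SmoothOn.hasFDerivAt_mul (h : SmoothOn F D) (hz : z ∈ D) (i j k l : Fin 2) (u : ℂ) :
    HasFDerivAt (fun w => entry F i j w * fderiv ℝ (entry F k l) w u)
      (entry F i j z • (fderiv ℝ (fderiv ℝ (entry F k l)) z).flip u +
        fderiv ℝ (entry F k l) z u • fderiv ℝ (entry F i j) z) z := by
  have h0 := ((h.contDiffAt hz i j).differentiableAt (by simp)).hasFDerivAt
  have h1 := (((h.contDiffAt hz k l).fderiv_right (m := ∞) (by simp)).differentiableAt
    (by simp)).hasFDerivAt
  have h2 := h1.clm_apply (hasFDerivAt_const u z)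
  simpa using h0.fun_mul h2

lemma SmoothOn.snd_symm (h : SmoothOn F D) (hz : z ∈ D) (i j : Fin 2) (u v : ℂ) :
    fderiv ℝ (fderiv ℝ (entry F i j)) z u v = fderiv ℝ (fderiv ℝ (entry F i j)) z v u :=
  ((h.contDiffAt hz i j).isSymmSndFDerivAt (by simp; exact ENat.LEInfty.out)) u v

lemma SmoothOn.det_deriv (h : SmoothOn F D) (hz : z ∈ D) (u : ℂ) :
    entry F 0 0 z * fderiv ℝ (entry F 1 1) z u + entry F 1 1 z * fderiv ℝ (entry F 0 0) z u -
      (entry F 0 1 z * fderiv ℝ (entry F 1 0) z u + entry F 1 0 z * fderiv ℝ (entry F 0 1) z u)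
      = 0 := by
  have h0 := fun i j => ((h.contDiffAt hz i j).differentiableAt (by simp)).hasFDerivAt
  have h1 := ((h0 0 0).mul (h0 1 1)).sub ((h0 0 1).mul (h0 1 0))
  have h2 : (entry F 0 0 * entry F 1 1 - entry F 0 1 * entry F 1 0) = fun _ => (1 : ℝ) := by
    ext w
    exact entry_det F w
  rw [h2] at h1
  have h3 := congrArg (fun l => l u) (h1.unique (hasFDerivAt_const (1 : ℝ) z))
  simpa using h3

/-- The Maurer-Cartan equation. -/
lemma SmoothOn.maurer_cartan (h : SmoothOn F D) (hz : z ∈ D) (u v : ℂ) :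
    fderiv ℝ (fun w => velocity F w v 0) z u - fderiv ℝ (fun w => velocity F w u 0) z v =
      -(1 / 2) * (velocity F z u 1 * velocity F z v 2 - velocity F z u 2 * velocity F z v 1) ∧
    fderiv ℝ (fun w => velocity F w v 1) z u - fderiv ℝ (fun w => velocity F w u 1) z v =
      1 / 2 * (velocity F z u 0 * velocity F z v 2 - velocity F z u 2 * velocity F z v 0) ∧
    fderiv ℝ (fun w => velocity F w v 2) z u - fderiv ℝ (fun w => velocity F w u 2) z v =
      2 * (velocity F z u 0 * velocity F z v 1 - velocity F z u 1 * velocity F z v 0) := by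
  have hd := entry_det F z
  have hu := h.det_deriv hz u
  have hv := h.det_deriv hz v
  have hs := fun i j => h.snd_symm hz i j u v
  have hm := fun i j k l u => h.hasFDerivAt_mul hz i j k l u
  have d0 : ∀ u v, fderiv ℝ (fun w => velocity F w u 0) z v = _ := fun u v => by
    simp only [velocity_zero_eq]
    rw [(((hm 1 1 0 0 u).fun_sub (hm 0 1 1 0 u)).fun_sub
      ((hm 0 0 1 1 u).fun_sub (hm 1 0 0 1 u))).fderiv]
  have d1 : ∀ u v, fderiv ℝ (fun w => velocity F w u 1) z v = _ := fun u v => by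
    simp only [velocity_one_eq]
    rw [(((hm 1 1 0 1 u).fun_sub (hm 0 1 1 1 u)).fun_add
      ((hm 0 0 1 0 u).fun_sub (hm 1 0 0 0 u))).fderiv]
  have d2 : ∀ u v, fderiv ℝ (fun w => velocity F w u 2) z v = _ := fun u v => by
    simp only [velocity_two_eq]
    rw [((((hm 0 0 1 0 u).fun_sub (hm 1 0 0 0 u)).fun_sub
      ((hm 1 1 0 1 u).fun_sub (hm 0 1 1 1 u))).const_mul (2 : ℝ)).fderiv]
  rw [d0, d0, d1, d1, d2, d2]
  simp only [velocity_zero_eq, velocity_one_eq, velocity_two_eq, _root_.sub_apply,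
    _root_.add_apply, _root_.smul_apply,
    ContinuousLinearMap.flip_apply, smul_eq_mul]
  -- Symmetry of second derivatives makes all second-order terms cancel. What remains is a
  -- polynomial identity in the entries and their first derivatives, modulo `det = 1` and its
  -- derivatives along `u` and `v`.
  rw [hs 0 0, hs 0 1, hs 1 0, hs 1 1]
  clear d0 d1 d2 hs hm
  generalize entry F 0 0 z = p at *
  generalize entry F 0 1 z = q at *
  generalize entry F 1 0 z = r at *
  generalize entry F 1 1 z = s at *
  generalize fderiv ℝ (entry F 0 0) z u = pu at *
  generalize fderiv ℝ (entry F 0 1) z u = qu at *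
  generalize fderiv ℝ (entry F 1 0) z u = ru at *
  generalize fderiv ℝ (entry F 1 1) z u = su at *
  generalize fderiv ℝ (entry F 0 0) z v = pv at *
  generalize fderiv ℝ (entry F 0 1) z v = qv at *
  generalize fderiv ℝ (entry F 1 0) z v = rv at *
  generalize fderiv ℝ (entry F 1 1) z v = sv at *
  refine ⟨?_, ?_, ?_⟩
  · grind
  · grind
  · grind

end SLTilde

namespace SLTilde

/-! ### Conformal immersions, the connection and the mean curvature. -/

/-- `F` is a smooth conformal immersion on the open set `D`. -/
structure ConformalOn (F : ℂ → SLTilde) (D : Set ℂ) : Prop extends SmoothOn F D where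
  sq_eq : ∀ z ∈ D, velocity F z 1 ⬝ᵥ velocity F z 1 =
    velocity F z Complex.I ⬝ᵥ velocity F z Complex.I
  orthogonal : ∀ z ∈ D, velocity F z 1 ⬝ᵥ velocity F z Complex.I = 0
  ne_zero : ∀ z ∈ D, velocity F z 1 ≠ 0

variable {F : ℂ → SLTilde} {D : Set ℂ} {z : ℂ}

/-- The contractions of the Levi-Civita connection are needed with `Y = v`: the first two components
then carry the coefficient `5 / 2 = 1 + 3 / 2`, and the third vanishes because `e₃` is a Killing
field. -/
lemma sum_connection_zero (v Y : Fin 3 → ℝ) :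
    ∑ k, ∑ j, v k * Y j * connection k j 0 = -(v 1 * Y 2) - 3 / 2 * (v 2 * Y 1) := by
  simp [Fin.sum_univ_three, connection, structureConst, coord, basis, Matrix.mul_apply]
  ring

lemma sum_connection_one (v Y : Fin 3 → ℝ) :
    ∑ k, ∑ j, v k * Y j * connection k j 1 = v 0 * Y 2 + 3 / 2 * (v 2 * Y 0) := by
  simp [Fin.sum_univ_three, connection, structureConst, coord, basis, Matrix.mul_apply]
  ring

lemma sum_connection_two (v Y : Fin 3 → ℝ) :
    ∑ k, ∑ j, v k * Y j * connection k j 2 = v 1 * Y 0 - v 0 * Y 1 := by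
  simp [Fin.sum_univ_three, connection, structureConst, coord, basis, Matrix.mul_apply]
  ring

lemma ConformalOn.conformalFactor_pos (h : ConformalOn F D) (hz : z ∈ D) :
    0 < conformalFactor F z := by
  have h0 : 0 ≤ conformalFactor F z := by
    simp only [conformalFactor, dotProduct, Fin.sum_univ_three]
    nlinarith
  exact lt_of_le_of_ne h0 fun h0 => h.ne_zero z hz (dotProduct_self_eq_zero.1 h0.symm)

lemma SmoothOn.fderiv_dotProduct (h : SmoothOn F D) (hz : z ∈ D) (u v w : ℂ) :
    fderiv ℝ (fun x => velocity F x u ⬝ᵥ velocity F x v) z w =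
      ∑ k, (velocity F z u k * fderiv ℝ (fun x => velocity F x v k) z w +
        velocity F z v k * fderiv ℝ (fun x => velocity F x u k) z w) := by
  have h1 := fun u k => (h.differentiableAt_velocity hz u k).hasFDerivAt
  have h2 := HasFDerivAt.fun_sum (u := Finset.univ) fun k _ => (h1 u k).fun_mul (h1 v k)
  change fderiv ℝ (fun x => ∑ k, velocity F x u k * velocity F x v k) z w = _
  rw [h2.fderiv]
  simp

lemma ConformalOn.fderiv_sq_eq (h : ConformalOn F D) (hz : z ∈ D) (w : ℂ) :
    ∑ k, velocity F z 1 k * fderiv ℝ (fun x => velocity F x 1 k) z w =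
      ∑ k, velocity F z Complex.I k * fderiv ℝ (fun x => velocity F x Complex.I k) z w := by
  have h1 : (fun x => velocity F x 1 ⬝ᵥ velocity F x 1) =ᶠ[nhds z]
      fun x => velocity F x Complex.I ⬝ᵥ velocity F x Complex.I :=
    Filter.mem_of_superset (h.isOpen.mem_nhds hz) h.sq_eq
  have h2 := congrArg (fun l : ℂ →L[ℝ] ℝ => l w) h1.fderiv_eq
  simp only [h.fderiv_dotProduct hz, ← two_mul, ← Finset.mul_sum] at h2
  linarith

lemma ConformalOn.fderiv_orthogonal (h : ConformalOn F D) (hz : z ∈ D) (w : ℂ) :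
    ∑ k, (velocity F z 1 k * fderiv ℝ (fun x => velocity F x Complex.I k) z w +
      velocity F z Complex.I k * fderiv ℝ (fun x => velocity F x 1 k) z w) = 0 := by
  have h1 : (fun x => velocity F x 1 ⬝ᵥ velocity F x Complex.I) =ᶠ[nhds z] fun x => 0 :=
    Filter.mem_of_superset (h.isOpen.mem_nhds hz) h.orthogonal
  have h2 := congrArg (fun l : ℂ →L[ℝ] ℝ => l w) h1.fderiv_eq
  simpa only [h.fderiv_dotProduct hz, fderiv_fun_const, Pi.zero_apply, _root_.zero_apply]
    using h2

/-- The trace of the second fundamental form is normal to the surface. -/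
lemma ConformalOn.laplacian_eq (h : ConformalOn F D) (hz : z ∈ D) :
    fderiv ℝ (fun x => velocity F x 1 0) z 1 +
        fderiv ℝ (fun x => velocity F x Complex.I 0) z Complex.I -
        5 / 2 * (velocity F z 1 1 * velocity F z 1 2 +
          velocity F z Complex.I 1 * velocity F z Complex.I 2) =
      2 * meanCurvature F z * (velocity F z 1 1 * velocity F z Complex.I 2 -
        velocity F z 1 2 * velocity F z Complex.I 1) ∧
    fderiv ℝ (fun x => velocity F x 1 1) z 1 +
        fderiv ℝ (fun x => velocity F x Complex.I 1) z Complex.I +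
        5 / 2 * (velocity F z 1 0 * velocity F z 1 2 +
          velocity F z Complex.I 0 * velocity F z Complex.I 2) =
      2 * meanCurvature F z * (velocity F z 1 2 * velocity F z Complex.I 0 -
        velocity F z 1 0 * velocity F z Complex.I 2) ∧
    fderiv ℝ (fun x => velocity F x 1 2) z 1 +
        fderiv ℝ (fun x => velocity F x Complex.I 2) z Complex.I =
      2 * meanCurvature F z * (velocity F z 1 0 * velocity F z Complex.I 1 -
        velocity F z 1 1 * velocity F z Complex.I 0) := by
  obtain ⟨m0, m1, m2⟩ := h.maurer_cartan hz 1 Complex.I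
  have he := (h.conformalFactor_pos hz).ne'
  have hsq := h.sq_eq z hz
  have hor := h.orthogonal z hz
  have s1 := h.fderiv_sq_eq hz 1
  have s2 := h.fderiv_sq_eq hz Complex.I
  have o1 := h.fderiv_orthogonal hz 1
  have o2 := h.fderiv_orthogonal hz Complex.I
  have hH : meanCurvature F z * (2 * conformalFactor F z ^ 2) =
      (covDeriv F (fun w => velocity F w 1) z 1 +
        covDeriv F (fun w => velocity F w Complex.I) z Complex.I) ⬝ᵥ
      (velocity F z 1 ⨯₃ velocity F z Complex.I) := by
    rw [meanCurvature, normal, dotProduct_smul, smul_eq_mul]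
    field_simp
  have hc : conformalFactor F z = velocity F z 1 0 * velocity F z 1 0 +
      velocity F z 1 1 * velocity F z 1 1 + velocity F z 1 2 * velocity F z 1 2 := by
    simp [conformalFactor, dotProduct, Fin.sum_univ_three]
  rw [dotProduct, Fin.sum_univ_three] at hH
  simp only [covDeriv, Pi.add_apply, sum_connection_zero, sum_connection_one, sum_connection_two, cross_apply,
    Matrix.cons_val_zero, Matrix.cons_val_one, Matrix.cons_val] at hH
  simp only [dotProduct, Fin.sum_univ_three] at hsq hor s1 s2 o1 o2
  generalize meanCurvature F z = H at *
  generalize conformalFactor F z = e at *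
  generalize fderiv ℝ (fun x => velocity F x 1 0) z 1 = a01 at *
  generalize fderiv ℝ (fun x => velocity F x 1 1) z 1 = a11 at *
  generalize fderiv ℝ (fun x => velocity F x 1 2) z 1 = a21 at *
  generalize fderiv ℝ (fun x => velocity F x 1 0) z Complex.I = a02 at *
  generalize fderiv ℝ (fun x => velocity F x 1 1) z Complex.I = a12 at *
  generalize fderiv ℝ (fun x => velocity F x 1 2) z Complex.I = a22 at *
  generalize fderiv ℝ (fun x => velocity F x Complex.I 0) z 1 = b01 at *
  generalize fderiv ℝ (fun x => velocity F x Complex.I 1) z 1 = b11 at *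
  generalize fderiv ℝ (fun x => velocity F x Complex.I 2) z 1 = b21 at *
  generalize fderiv ℝ (fun x => velocity F x Complex.I 0) z Complex.I = b02 at *
  generalize fderiv ℝ (fun x => velocity F x Complex.I 1) z Complex.I = b12 at *
  generalize fderiv ℝ (fun x => velocity F x Complex.I 2) z Complex.I = b22 at *
  generalize velocity F z 1 0 = a0 at *
  generalize velocity F z 1 1 = a1 at *
  generalize velocity F z 1 2 = a2 at *
  generalize velocity F z Complex.I 0 = b0 at *
  generalize velocity F z Complex.I 1 = b1 at *
  generalize velocity F z Complex.I 2 = b2 at *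
  -- `t` is the vector `∇_x f_x + ∇_y f_y` in the frame, where `a`, `b` are the components of `f_x`,
  -- `f_y`.
  obtain ⟨t0, ht0⟩ : ∃ t, t = a01 + b02 - 5 / 2 * (a1 * a2 + b1 * b2) := ⟨_, rfl⟩
  obtain ⟨t1, ht1⟩ : ∃ t, t = a11 + b12 + 5 / 2 * (a0 * a2 + b0 * b2) := ⟨_, rfl⟩
  obtain ⟨t2, ht2⟩ : ∃ t, t = a21 + b22 := ⟨_, rfl⟩
  -- `t` is orthogonal to `f_x`: differentiated conformality reduces `t · f_x` to the pairing of
  -- `f_y` with `∂_x f_y - ∂_y f_x` plus connection terms, and the Maurer-Cartan equation cancels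
  -- these. `hB` treats `f_y` in the same way.
  have hA : t0 * a0 + t1 * a1 + t2 * a2 = 0 := by
    rw [ht0, ht1, ht2]
    linear_combination s1 + o2 + b0 * m0 + b1 * m1 + b2 * m2
  have hB : t0 * b0 + t1 * b1 + t2 * b2 = 0 := by
    rw [ht0, ht1, ht2]
    linear_combination o1 - s2 - a0 * m0 - a1 * m1 - a2 * m2
  have hT : 2 * e ^ 2 * H = t0 * (a1 * b2 - a2 * b1) + t1 * (a2 * b0 - a0 * b2) +
      t2 * (a0 * b1 - a1 * b0) := by
    rw [ht0, ht1, ht2]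
    linear_combination hH
  -- Lagrange's identity for `|f_x × f_y|²`, with `f_x`, `f_y` orthogonal and of equal length.
  have hC : e ^ 2 = (a1 * b2 - a2 * b1) ^ 2 + (a2 * b0 - a0 * b2) ^ 2 +
      (a0 * b1 - a1 * b0) ^ 2 := by
    rw [hc]
    linear_combination (a0 * a0 + a1 * a1 + a2 * a2) * hsq + (a0 * b0 + a1 * b1 + a2 * b2) * hor
  rw [← ht0, ← ht1, ← ht2]
  clear hH ht0 ht1 ht2 s1 s2 o1 o2 m0 m1 m2
  have he2 := pow_ne_zero 2 he
  -- With `n = f_x × f_y`, one has `|n|² t - (t · n) n = n × (t × n)` and `t × n = (t · f_y) f_x -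
  -- (t · f_x) f_y`; the coefficients of `hA` and `hB` below are the components of the resulting
  -- cross products.
  refine ⟨mul_left_cancel₀ he2 ?_, mul_left_cancel₀ he2 ?_, mul_left_cancel₀ he2 ?_⟩
  · linear_combination t0 * hC - (a1 * b2 - a2 * b1) * hT +
      (b1 * (a0 * b1 - a1 * b0) - b2 * (a2 * b0 - a0 * b2)) * hA +
      ((a2 * b0 - a0 * b2) * a2 - (a0 * b1 - a1 * b0) * a1) * hB
  · linear_combination t1 * hC - (a2 * b0 - a0 * b2) * hT +
      (b2 * (a1 * b2 - a2 * b1) - b0 * (a0 * b1 - a1 * b0)) * hA +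
      ((a0 * b1 - a1 * b0) * a0 - (a1 * b2 - a2 * b1) * a2) * hB
  · linear_combination t2 * hC - (a0 * b1 - a1 * b0) * hT +
      (b0 * (a2 * b0 - a0 * b2) - b1 * (a1 * b2 - a2 * b1)) * hA +
      ((a1 * b2 - a2 * b1) * a1 - (a2 * b0 - a0 * b2) * a0) * hB

lemma SmoothOn.contDiffAt_fderiv_velocity (h : SmoothOn F D) (hz : z ∈ D) (u v : ℂ) (k : Fin 3) :
    ContDiffAt ℝ ∞ (fun w => fderiv ℝ (fun x => velocity F x u k) w v) z :=
  ((h.contDiffAt_velocity hz u k).fderiv_right (m := ∞) (by simp)).clm_apply contDiffAt_const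

lemma ConformalOn.continuousAt_meanCurvature (h : ConformalOn F D) (hz : z ∈ D) :
    ContinuousAt (meanCurvature F) z := by
  have he := (h.conformalFactor_pos hz).ne'
  have c0 := fun u k => (h.contDiffAt_velocity hz u k).continuousAt
  have c1 := fun u v k => (h.contDiffAt_fderiv_velocity hz u v k).continuousAt
  have c2 : ContinuousAt (fun w => ∑ k, velocity F w 1 k * velocity F w 1 k) z :=
    tendsto_finsetSum _ fun k _ => (c0 1 k).mul (c0 1 k)
  change ContinuousAt (conformalFactor F) z at c2
  have c3 : ∀ u k, ContinuousAt (fun w => covDeriv F (fun x => velocity F x u) w u k) z :=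
    fun u k => (c1 u u k).add (tendsto_finsetSum _ fun i _ => tendsto_finsetSum _ fun j _ =>
      ((c0 u i).mul (c0 u j)).mul_const _)
  have c4 : ∀ k, ContinuousAt (fun w => normal F w k) z := by
    intro k
    refine (c2.inv₀ he).mul ?_
    fin_cases k
    · simp only [Fin.zero_eta, cross_apply, Matrix.cons_val_zero]
      exact ((c0 1 1).mul (c0 Complex.I 2)).sub ((c0 1 2).mul (c0 Complex.I 1))
    · simp only [Fin.mk_one, cross_apply, Matrix.cons_val_one, Matrix.cons_val_zero]
      exact ((c0 1 2).mul (c0 Complex.I 0)).sub ((c0 1 0).mul (c0 Complex.I 2))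
    · simp only [Fin.reduceFinMk, cross_apply, Matrix.cons_val]
      exact ((c0 1 0).mul (c0 Complex.I 1)).sub ((c0 1 1).mul (c0 Complex.I 0))
  have c5 : ContinuousAt (fun w => ∑ k, (covDeriv F (fun x => velocity F x 1) w 1 k +
      covDeriv F (fun x => velocity F x Complex.I) w Complex.I k) * normal F w k) z :=
    tendsto_finsetSum _ fun k _ => ((c3 1 k).add (c3 Complex.I k)).mul (c4 k)
  exact c5.div (continuousAt_const.mul c2) (mul_ne_zero two_ne_zero he)

lemma SmoothOn.contDiffAt_zCoeff (h : SmoothOn F D) (hz : z ∈ D) (k : Fin 3) :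
    ContDiffAt ℝ ∞ (fun w => zCoeff F w k) z := by
  have c := fun u => Complex.ofRealCLM.contDiff.contDiffAt.comp z (h.contDiffAt_velocity hz u k)
  exact ((c 1).sub (contDiffAt_const.mul (c Complex.I))).div_const 2

/-! ### Generating spinors: their squares, local existence and non-vanishing. -/

/-- The square of the first component of a generating spinor. -/
def sqFst (F : ℂ → SLTilde) (z : ℂ) : ℂ := -Complex.I * zCoeff F z 0 - zCoeff F z 1

/-- The square of the conjugate of the second component of a generating spinor. -/
def sqSnd (F : ℂ → SLTilde) (z : ℂ) : ℂ := -Complex.I * zCoeff F z 0 + zCoeff F z 1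

lemma SmoothOn.contDiffAt_sqFst (h : SmoothOn F D) (hz : z ∈ D) :
    ContDiffAt ℝ ∞ (sqFst F) z :=
  (contDiffAt_const.mul (h.contDiffAt_zCoeff hz 0)).sub (h.contDiffAt_zCoeff hz 1)

lemma SmoothOn.contDiffAt_sqSnd (h : SmoothOn F D) (hz : z ∈ D) :
    ContDiffAt ℝ ∞ (sqSnd F) z :=
  (contDiffAt_const.mul (h.contDiffAt_zCoeff hz 0)).add (h.contDiffAt_zCoeff hz 1)

/-- A linear change of coordinates isolates the three quadratic monomials of the spinor, to which
the product rule can be applied. It also expresses `|ψ₁|²` and `|ψ₂|²` through `Z` alone, with no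
choice of sign. -/
lemma isSpinor_iff {ψ : ℂ × ℂ} : IsSpinor (zCoeff F z) ψ ↔
    ψ.1 ^ 2 = sqFst F z ∧ (starRingEnd ℂ) ψ.2 ^ 2 = sqSnd F z ∧
      ψ.1 * (starRingEnd ℂ) ψ.2 = zCoeff F z 2 := by
  have hI := Complex.I_sq
  rw [IsSpinor, sqFst, sqSnd]
  constructor
  · rintro ⟨h0, h1, h2⟩
    refine ⟨?_, ?_, h2.symm⟩
    · rw [h0, h1]
      linear_combination (1 / 2 * ((starRingEnd ℂ) ψ.2 ^ 2 + ψ.1 ^ 2)) * hI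
    · rw [h0, h1]
      linear_combination (1 / 2 * ((starRingEnd ℂ) ψ.2 ^ 2 + ψ.1 ^ 2)) * hI
  · rintro ⟨h1, h2, h3⟩
    refine ⟨?_, ?_, h3.symm⟩
    · rw [h1, h2]
      linear_combination zCoeff F z 0 * hI
    · rw [h1, h2]
      ring

lemma IsSpinor.norm_fst_sq {ψ : ℂ × ℂ} (h : IsSpinor (zCoeff F z) ψ) :
    ‖ψ.1‖ ^ 2 = ‖sqFst F z‖ := by
  rw [← (isSpinor_iff.1 h).1, norm_pow]

lemma IsSpinor.norm_snd_sq {ψ : ℂ × ℂ} (h : IsSpinor (zCoeff F z) ψ) :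
    ‖ψ.2‖ ^ 2 = ‖sqSnd F z‖ := by
  rw [← (isSpinor_iff.1 h).2.1, norm_pow, RCLike.norm_conj]

/-- This is the isotropy `Z₁² + Z₂² + Z₃² = 0`, whose real and imaginary parts are the two
conformality conditions. -/
lemma ConformalOn.sqFst_mul_sqSnd (h : ConformalOn F D) (hz : z ∈ D) :
    sqFst F z * sqSnd F z = zCoeff F z 2 ^ 2 := by
  have h1 := h.sq_eq z hz
  have h2 := h.orthogonal z hz
  simp only [dotProduct, Fin.sum_univ_three] at h1 h2
  have h1' := congrArg ((↑) : ℝ → ℂ) h1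
  have h2' := congrArg ((↑) : ℝ → ℂ) h2
  push_cast at h1' h2'
  simp only [sqFst, sqSnd, zCoeff]
  linear_combination (((velocity F z 1 0 - Complex.I * velocity F z Complex.I 0) / 2) ^ 2 -
    ((velocity F z Complex.I 0 : ℂ) ^ 2 + velocity F z Complex.I 1 ^ 2 +
      velocity F z Complex.I 2 ^ 2) / 4) * Complex.I_sq - h1' / 4 + Complex.I / 2 * h2'

lemma ConformalOn.sqFst_ne_zero_or (h : ConformalOn F D) (hz : z ∈ D) :
    sqFst F z ≠ 0 ∨ sqSnd F z ≠ 0 := by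
  by_contra! hc
  have h2 : zCoeff F z 2 = 0 := by
    have := h.sqFst_mul_sqSnd hz
    rw [hc.1, zero_mul] at this
    exact pow_eq_zero_iff two_ne_zero |>.1 this.symm
  have h1 : zCoeff F z 1 = 0 := by
    have := hc.2
    have h3 := hc.1
    rw [sqFst] at h3
    rw [sqSnd] at this
    linear_combination (this - h3) / 2
  have h0 : zCoeff F z 0 = 0 := by
    have := hc.2
    rw [sqSnd, h1, add_zero] at this
    simpa using this
  refine h.ne_zero z hz (funext fun k => ?_)
  have hk : zCoeff F z k = 0 := by fin_cases k <;> assumption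
  have := congrArg Complex.re hk
  simpa [zCoeff] using this

/-- Division by `f z` moves the value at `z` to `1`, where the principal logarithm is smooth; half
the logarithm then gives the root. -/
lemma exists_local_sqrt {f : ℂ → ℂ} {n : WithTop ℕ∞} (hf : ContDiffAt ℝ n f z) (h0 : f z ≠ 0) :
    ∃ g : ℂ → ℂ, ContDiffAt ℝ n g z ∧ ∀ᶠ w in nhds z, g w ^ 2 = f w ∧ g w ≠ 0 := by
  obtain ⟨c, hc⟩ := IsAlgClosed.exists_pow_nat_eq (f z) two_pos
  have hc0 : c ≠ 0 := by rintro rfl; exact h0 (by rw [← hc]; simp)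
  have h1 : ContDiffAt ℝ n (fun w => f w / f z) z := hf.div_const _
  have h2 : f z / f z ∈ Complex.slitPlane := by
    rw [div_self h0]; exact Complex.one_mem_slitPlane
  refine ⟨fun w => c * Complex.exp (Complex.log (f w / f z) / 2), ?_, ?_⟩
  · have h3 : ContDiffAt ℝ n (fun w => Complex.log (f w / f z)) z :=
      ContDiffAt.comp (g := Complex.log) z ((Complex.contDiffAt_log h2).restrict_scalars ℝ) h1
    exact contDiffAt_const.mul (h3.div_const 2).cexp
  · filter_upwards [hf.continuousAt.eventually_ne h0] with w hw
    refine ⟨?_, mul_ne_zero hc0 (Complex.exp_ne_zero _)⟩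
    rw [mul_pow, ← Complex.exp_nat_mul, Nat.cast_ofNat, mul_div_cancel₀ _ two_ne_zero,
      Complex.exp_log (div_ne_zero hw h0), hc, mul_div_cancel₀ _ h0]

/-- One of `sqFst`, `sqSnd` is nonzero at `z`. A root of that one is one component, up to
conjugation; dividing `Z₃` by the root gives the other, and isotropy makes its square correct. -/
lemma ConformalOn.exists_local_spinor (h : ConformalOn F D) (hz : z ∈ D) :
    ∃ Ω : Set ℂ, IsOpen Ω ∧ z ∈ Ω ∧ Ω ⊆ D ∧ ∃ ψ₁ ψ₂ : ℂ → ℂ,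
      ContDiffOn ℝ 1 ψ₁ Ω ∧ ContDiffOn ℝ 1 ψ₂ Ω ∧
      ∀ w ∈ Ω, IsSpinor (zCoeff F w) (ψ₁ w, ψ₂ w) := by
  suffices hs : ∃ ψ₁ ψ₂ : ℂ → ℂ, ContDiffAt ℝ 1 ψ₁ z ∧ ContDiffAt ℝ 1 ψ₂ z ∧
      ∀ᶠ w in nhds z, IsSpinor (zCoeff F w) (ψ₁ w, ψ₂ w) by
    obtain ⟨ψ₁, ψ₂, h1, h2, h3⟩ := hs
    have e1 := h1.eventually (by simp)
    have e2 := h2.eventually (by simp)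
    obtain ⟨Ω, hΩ, ho, hzΩ⟩ := eventually_nhds_iff.1
      (((e1.and e2).and h3).and (h.isOpen.mem_nhds hz))
    exact ⟨Ω, ho, hzΩ, fun w hw => (hΩ w hw).2, ψ₁, ψ₂,
      fun w hw => (hΩ w hw).1.1.1.contDiffWithinAt, fun w hw => (hΩ w hw).1.1.2.contDiffWithinAt,
      fun w hw => (hΩ w hw).1.2⟩
  have c2 : ContDiffAt ℝ 1 (fun w => zCoeff F w 2) z := (h.contDiffAt_zCoeff hz 2).of_le (by simp)
  have hc : ContDiff ℝ 1 (fun w : ℂ => (starRingEnd ℂ) w) := Complex.conjCLE.contDiff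
  rcases h.sqFst_ne_zero_or hz with h0 | h0
  · obtain ⟨g, hg, hg2⟩ := exists_local_sqrt ((h.contDiffAt_sqFst hz).of_le (m := 1) (by simp)) h0
    have hq : ContDiffAt ℝ 1 (fun w => zCoeff F w 2 / g w) z := by
      simpa only [div_eq_mul_inv, Pi.inv_apply] using c2.mul (hg.inv hg2.self_of_nhds.2)
    refine ⟨g, fun w => (starRingEnd ℂ) (zCoeff F w 2 / g w), hg,
      hc.contDiffAt.comp z hq, ?_⟩
    filter_upwards [hg2, h.isOpen.mem_nhds hz] with w hw hwD
    have := h.sqFst_mul_sqSnd hwD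
    refine isSpinor_iff.2 ⟨hw.1, ?_, ?_⟩
    · have h1 := hw.2
      rw [Complex.conj_conj, div_pow, ← this, ← hw.1]
      field_simp
    · have h1 := hw.2
      rw [Complex.conj_conj]
      field_simp
  · obtain ⟨g, hg, hg2⟩ := exists_local_sqrt ((h.contDiffAt_sqSnd hz).of_le (m := 1) (by simp)) h0
    have hq : ContDiffAt ℝ 1 (fun w => zCoeff F w 2 / g w) z := by
      simpa only [div_eq_mul_inv, Pi.inv_apply] using c2.mul (hg.inv hg2.self_of_nhds.2)
    refine ⟨fun w => zCoeff F w 2 / g w, fun w => (starRingEnd ℂ) (g w),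
      hq, hc.contDiffAt.comp z hg, ?_⟩
    filter_upwards [hg2, h.isOpen.mem_nhds hz] with w hw hwD
    have := h.sqFst_mul_sqSnd hwD
    refine isSpinor_iff.2 ⟨?_, ?_, ?_⟩
    · have h1 := hw.2
      rw [div_pow, ← this, ← hw.1]
      field_simp
    · rw [Complex.conj_conj]
      exact hw.1
    · have h1 := hw.2
      rw [Complex.conj_conj]
      field_simp

lemma ConformalOn.isSpinor_spinor (h : ConformalOn F D) (hz : z ∈ D) :
    IsSpinor (zCoeff F z) (spinor F z) := by
  obtain ⟨Ω, -, hzΩ, -, ψ₁, ψ₂, -, -, hψ⟩ := h.exists_local_spinor hz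
  exact Classical.epsilon_spec ⟨_, hψ z hzΩ⟩

/-! ### Wirtinger derivatives, the potentials and the Dirac equation. -/

lemma wirtingerBar_mul {f g : ℂ → ℂ} (hf : DifferentiableAt ℝ f z) (hg : DifferentiableAt ℝ g z) :
    wirtingerBar (fun w => f w * g w) z = f z * wirtingerBar g z + wirtingerBar f z * g z := by
  simp only [wirtingerBar, (hf.hasFDerivAt.fun_mul hg.hasFDerivAt).fderiv, _root_.add_apply,
    _root_.smul_apply, smul_eq_mul]
  ring

lemma wirtingerBar_conj {f : ℂ → ℂ} (hf : DifferentiableAt ℝ f z) :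
    wirtingerBar (fun w => (starRingEnd ℂ) (f w)) z = (starRingEnd ℂ) (wirtinger f z) := by
  have h1 := (Complex.conjCLE : ℂ →L[ℝ] ℂ).hasFDerivAt.comp z hf.hasFDerivAt
  have h2 : HasFDerivAt (fun w => (starRingEnd ℂ) (f w)) _ z := h1
  simp [wirtingerBar, wirtinger, h2.fderiv, Complex.conj_ofNat]

lemma wirtingerBar_linear {f g : ℂ → ℂ} (hf : DifferentiableAt ℝ f z)
    (hg : DifferentiableAt ℝ g z) (a b : ℂ) :
    wirtingerBar (fun w => a * f w + b * g w) z = a * wirtingerBar f z + b * wirtingerBar g z := by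
  simp only [wirtingerBar, ((hf.hasFDerivAt.const_mul a).fun_add
    (hg.hasFDerivAt.const_mul b)).fderiv, _root_.add_apply,
    _root_.smul_apply, smul_eq_mul]
  ring

lemma wirtingerBar_congr {f g : ℂ → ℂ} (h : f =ᶠ[nhds z] g) :
    wirtingerBar f z = wirtingerBar g z := by
  rw [wirtingerBar, wirtingerBar, h.fderiv_eq]

/-- The two brackets are the divergence, governed by the mean curvature, and the curl, governed by
the Maurer-Cartan equation. -/
lemma SmoothOn.wirtingerBar_zCoeff (h : SmoothOn F D) (hz : z ∈ D) (k : Fin 3) :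
    4 * wirtingerBar (fun w => zCoeff F w k) z =
      ((fderiv ℝ (fun x => velocity F x 1 k) z 1 +
        fderiv ℝ (fun x => velocity F x Complex.I k) z Complex.I : ℝ) : ℂ) -
      Complex.I * ((fderiv ℝ (fun x => velocity F x Complex.I k) z 1 -
        fderiv ℝ (fun x => velocity F x 1 k) z Complex.I : ℝ) : ℂ) := by
  have c := fun u => Complex.ofRealCLM.hasFDerivAt.comp z
    (h.differentiableAt_velocity hz u k).hasFDerivAt
  have c1 : ∀ u, HasFDerivAt (fun w => (velocity F w u k : ℂ)) _ z := c
  have c2 : HasFDerivAt (fun w => zCoeff F w k) _ z :=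
    ((c1 1).fun_sub ((c1 Complex.I).const_mul Complex.I)).mul_const (1 / 2 : ℂ) |>.congr_of_eventuallyEq
      (Filter.Eventually.of_forall fun w => by simp [zCoeff, div_eq_mul_inv])
  rw [wirtingerBar, c2.fderiv]
  simp
  linear_combination -(fderiv ℝ (fun x => velocity F x Complex.I k) z Complex.I : ℂ) * Complex.I_sq

/-- The first potential of the Dirac operator. -/
def potentialFst (F : ℂ → SLTilde) (z : ℂ) : ℂ :=
  meanCurvature F z / 2 * (‖sqFst F z‖ + ‖sqSnd F z‖) +
    Complex.I * (1 / 2 * ‖sqFst F z‖ - 3 / 4 * ‖sqSnd F z‖)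

/-- The second potential of the Dirac operator. -/
def potentialSnd (F : ℂ → SLTilde) (z : ℂ) : ℂ :=
  meanCurvature F z / 2 * (‖sqFst F z‖ + ‖sqSnd F z‖) +
    Complex.I * (3 / 4 * ‖sqFst F z‖ - 1 / 2 * ‖sqSnd F z‖)

/-- The `∂̄`-derivative of `Z` in terms of a generating spinor. -/
lemma ConformalOn.wirtingerBar_zCoeff_eq (h : ConformalOn F D) (hz : z ∈ D) {ψ : ℂ × ℂ}
    (hψ : IsSpinor (zCoeff F z) ψ) :
    wirtingerBar (fun w => zCoeff F w 0) z = Complex.I * (ψ.1 * (potentialSnd F z * ψ.2) -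
      (starRingEnd ℂ) ψ.2 * ((starRingEnd ℂ) (potentialFst F z) * (starRingEnd ℂ) ψ.1)) ∧
    wirtingerBar (fun w => zCoeff F w 1) z = -(ψ.1 * (potentialSnd F z * ψ.2)) -
      (starRingEnd ℂ) ψ.2 * ((starRingEnd ℂ) (potentialFst F z) * (starRingEnd ℂ) ψ.1) ∧
    wirtingerBar (fun w => zCoeff F w 2) z = (starRingEnd ℂ) ψ.2 * (potentialSnd F z * ψ.2) -
      ψ.1 * ((starRingEnd ℂ) (potentialFst F z) * (starRingEnd ℂ) ψ.1) := by
  obtain ⟨m0, m1, m2⟩ := h.maurer_cartan hz 1 Complex.I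
  obtain ⟨l0, l1, l2⟩ := h.laplacian_eq hz
  have w := fun k => h.wirtingerBar_zCoeff hz k
  have w0 := w 0
  have w1 := w 1
  have w2 := w 2
  rw [m0, eq_add_of_sub_eq l0] at w0
  rw [m1, eq_sub_of_add_eq l1] at w1
  rw [m2, l2] at w2
  -- All velocities are rewritten through `Z` and its conjugate, hence through the spinor. With the
  -- conjugates as independent variables the claim becomes polynomial, and the conformality
  -- relations are built into the parametrization.
  have hA : ∀ k, (velocity F z 1 k : ℂ) = zCoeff F z k + (starRingEnd ℂ) (zCoeff F z k) := by
    intro k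
    simp [zCoeff, Complex.conj_ofNat]
    ring
  have hB : ∀ k, (velocity F z Complex.I k : ℂ) =
      Complex.I * (zCoeff F z k - (starRingEnd ℂ) (zCoeff F z k)) := by
    intro k
    simp [zCoeff, Complex.conj_ofNat]
    linear_combination (velocity F z Complex.I k : ℂ) * Complex.I_sq
  have n1 : (‖sqFst F z‖ : ℂ) = ψ.1 * (starRingEnd ℂ) ψ.1 := by
    rw [← hψ.norm_fst_sq, Complex.mul_conj, Complex.normSq_eq_norm_sq]
  have n2 : (‖sqSnd F z‖ : ℂ) = ψ.2 * (starRingEnd ℂ) ψ.2 := by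
    rw [← hψ.norm_snd_sq, Complex.mul_conj, Complex.normSq_eq_norm_sq]
  push_cast at w0 w1 w2
  simp only [hA, hB, hψ.1, hψ.2.1, hψ.2.2, map_mul, map_add, map_sub, map_pow, map_div₀,
    map_ofNat, map_one, Complex.conj_I, Complex.conj_conj] at w0 w1 w2
  simp only [potentialFst, potentialSnd, map_mul, map_add, map_sub, map_div₀, map_ofNat, map_one,
    Complex.conj_I, Complex.conj_ofReal, n1, n2, Complex.conj_conj]
  clear w hA hB n1 n2 m0 m1 m2 l0 l1 l2
  generalize (starRingEnd ℂ) ψ.1 = x' at *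
  generalize (starRingEnd ℂ) ψ.2 = y' at *
  generalize ψ.1 = x at *
  generalize ψ.2 = y at *
  generalize (meanCurvature F z : ℂ) = H at *
  generalize wirtingerBar (fun w => zCoeff F w 0) z = W0 at *
  generalize wirtingerBar (fun w => zCoeff F w 1) z = W1 at *
  generalize wirtingerBar (fun w => zCoeff F w 2) z = W2 at *
  have hI := Complex.I_sq
  generalize Complex.I = i at *
  refine ⟨?_, ?_, ?_⟩
  · grind
  · grind
  · grind

lemma ConformalOn.continuousAt_potentials (h : ConformalOn F D) (hz : z ∈ D) :
    ContinuousAt (potentialFst F) z ∧ ContinuousAt (potentialSnd F) z := by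
  have c0 := Complex.continuous_ofReal.continuousAt.comp (h.continuousAt_meanCurvature hz)
  have c1 := Complex.continuous_ofReal.continuousAt.comp ((h.contDiffAt_sqFst hz).continuousAt.norm)
  have c2 := Complex.continuous_ofReal.continuousAt.comp ((h.contDiffAt_sqSnd hz).continuousAt.norm)
  exact ⟨((c0.div_const 2).mul (c1.add c2)).add (continuousAt_const.mul
    ((continuousAt_const.mul c1).sub (continuousAt_const.mul c2))),
    ((c0.div_const 2).mul (c1.add c2)).add (continuousAt_const.mul
    ((continuousAt_const.mul c1).sub (continuousAt_const.mul c2)))⟩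

/-- Let `X`, `Y` be the left-hand sides of the second and first Dirac equations. Applying `∂̄` to
`ψ₁²`, `ψ̄₂²` and `ψ₁ψ̄₂` and comparing with `∂̄Z` gives `ψ₁X = 0`, `ψ̄₂Ȳ = 0` and `ψ₁Ȳ = ψ̄₂X`.
Since the spinor has no zeros, `X = Y = 0`. -/
lemma ConformalOn.isDiracPotential (h : ConformalOn F D) :
    IsDiracPotential F D (potentialFst F) (potentialSnd F) := by
  refine ⟨fun z hz => (h.continuousAt_potentials hz).1.continuousWithinAt,
    fun z hz => (h.continuousAt_potentials hz).2.continuousWithinAt, ?_⟩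
  intro Ω hΩ hΩD ψ₁ ψ₂ h1 h2 hψ z hz
  have d1 : DifferentiableAt ℝ ψ₁ z := (h1.contDiffAt (hΩ.mem_nhds hz)).differentiableAt (by simp)
  have d2 : DifferentiableAt ℝ ψ₂ z := (h2.contDiffAt (hΩ.mem_nhds hz)).differentiableAt (by simp)
  have d3 : DifferentiableAt ℝ (fun w => (starRingEnd ℂ) (ψ₂ w)) z :=
    Complex.conjCLE.differentiableAt.comp z d2
  have dz := fun k => (h.contDiffAt_zCoeff (hΩD hz) k).differentiableAt (by simp)
  have hev : ∀ᶠ w in nhds z, w ∈ Ω := hΩ.mem_nhds hz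
  have e1 : 2 * (ψ₁ z * wirtingerBar ψ₁ z) =
      -Complex.I * wirtingerBar (fun w => zCoeff F w 0) z +
        -1 * wirtingerBar (fun w => zCoeff F w 1) z := by
    rw [← wirtingerBar_linear (dz 0) (dz 1), ← wirtingerBar_congr (f := fun w => ψ₁ w * ψ₁ w)
      (g := fun w => -Complex.I * zCoeff F w 0 + -1 * zCoeff F w 1), wirtingerBar_mul d1 d1]
    · ring
    · filter_upwards [hev] with w hw
      rw [← sq, (isSpinor_iff.1 (hψ w hw)).1, sqFst]
      ring
  have e2 : 2 * ((starRingEnd ℂ) (ψ₂ z) * wirtingerBar (fun w => (starRingEnd ℂ) (ψ₂ w)) z) =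
      -Complex.I * wirtingerBar (fun w => zCoeff F w 0) z +
        1 * wirtingerBar (fun w => zCoeff F w 1) z := by
    rw [← wirtingerBar_linear (dz 0) (dz 1), ← wirtingerBar_congr
      (f := fun w => (starRingEnd ℂ) (ψ₂ w) * (starRingEnd ℂ) (ψ₂ w))
      (g := fun w => -Complex.I * zCoeff F w 0 + 1 * zCoeff F w 1), wirtingerBar_mul d3 d3]
    · ring
    · filter_upwards [hev] with w hw
      rw [← sq, (isSpinor_iff.1 (hψ w hw)).2.1, sqSnd]
      ring
  have e3 : ψ₁ z * wirtingerBar (fun w => (starRingEnd ℂ) (ψ₂ w)) z +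
      wirtingerBar ψ₁ z * (starRingEnd ℂ) (ψ₂ z) = wirtingerBar (fun w => zCoeff F w 2) z := by
    rw [← wirtingerBar_mul d1 d3]
    refine wirtingerBar_congr ?_
    filter_upwards [hev] with w hw
    exact (isSpinor_iff.1 (hψ w hw)).2.2
  obtain ⟨w0, w1, w2⟩ := h.wirtingerBar_zCoeff_eq (hΩD hz) (hψ z hz)
  have hs := isSpinor_iff.1 (hψ z hz)
  rw [w0, w1] at e1 e2
  rw [w2] at e3
  rw [wirtingerBar_conj d2] at e2 e3
  dsimp only at e1 e2 e3 hs
  have hI := Complex.I_sq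
  have f1 : ψ₁ z * (-wirtingerBar ψ₁ z + potentialSnd F z * ψ₂ z) = 0 := by
    linear_combination -e1 / 2 + (ψ₁ z * (potentialSnd F z * ψ₂ z) - (starRingEnd ℂ) (ψ₂ z) *
      ((starRingEnd ℂ) (potentialFst F z) * (starRingEnd ℂ) (ψ₁ z))) / 2 * hI
  have f2 : (starRingEnd ℂ) (ψ₂ z) * (starRingEnd ℂ) (wirtinger ψ₂ z + potentialFst F z * ψ₁ z)
      = 0 := by
    rw [map_add, map_mul]
    linear_combination e2 / 2 - (ψ₁ z * (potentialSnd F z * ψ₂ z) - (starRingEnd ℂ) (ψ₂ z) *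
      ((starRingEnd ℂ) (potentialFst F z) * (starRingEnd ℂ) (ψ₁ z))) / 2 * hI
  have f3 : ψ₁ z * (starRingEnd ℂ) (wirtinger ψ₂ z + potentialFst F z * ψ₁ z) =
      (starRingEnd ℂ) (ψ₂ z) * (-wirtingerBar ψ₁ z + potentialSnd F z * ψ₂ z) := by
    rw [map_add, map_mul]
    linear_combination e3
  by_cases h0 : ψ₁ z = 0
  · have h4 : (starRingEnd ℂ) (ψ₂ z) ≠ 0 := by
      intro h5
      rcases h.sqFst_ne_zero_or (hΩD hz) with h6 | h6
      · exact h6 (by rw [← hs.1, h0]; simp)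
      · exact h6 (by rw [← hs.2.1, h5]; simp)
    refine ⟨?_, ?_⟩
    · exact (map_eq_zero _).1 ((mul_eq_zero.1 f2).resolve_left h4)
    · rw [h0, zero_mul] at f3
      exact (mul_eq_zero.1 f3.symm).resolve_left h4
  · have h5 := (mul_eq_zero.1 f1).resolve_left h0
    refine ⟨?_, h5⟩
    rw [h5, mul_zero] at f3
    exact (map_eq_zero _).1 ((mul_eq_zero.1 f3).resolve_left h0)

/-! ### Uniqueness of the potentials. -/

lemma eqOn_of_ne_subset_empty {D : Set ℂ} (hD : IsOpen D) {f g : ℂ → ℂ} (hf : ContinuousOn f D)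
    (hg : ContinuousOn g D)
    (h : ∀ O : Set ℂ, IsOpen O → O ⊆ D → (∀ w ∈ O, f w ≠ g w) → O = ∅) : Set.EqOn f g D := by
  intro z hz
  by_contra hne
  have h1 : IsOpen (D ∩ (fun w => f w - g w) ⁻¹' {0}ᶜ) :=
    (hf.sub hg).isOpen_inter_preimage hD isOpen_compl_singleton
  have h2 := h _ h1 Set.inter_subset_left fun w hw => sub_ne_zero.1 hw.2
  exact Set.eq_empty_iff_forall_notMem.1 h2 z ⟨hz, sub_ne_zero.2 hne⟩

/-- The equations fix `U` where `ψ₁ ≠ 0` and `V` where `ψ₂ ≠ 0`. By continuity it is enough that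
neither component vanishes on a nonempty open set. -/
lemma ConformalOn.isDiracPotential_unique (h : ConformalOn F D) {U V : ℂ → ℂ}
    (hUV : IsDiracPotential F D U V) :
    Set.EqOn U (potentialFst F) D ∧ Set.EqOn V (potentialSnd F) D := by
  have h0 := h.isDiracPotential
  have hw : ∀ w ∈ D, ∃ Ω : Set ℂ, IsOpen Ω ∧ w ∈ Ω ∧ Ω ⊆ D ∧ ∃ ψ₁ ψ₂ : ℂ → ℂ,
      ∀ x ∈ Ω, IsSpinor (zCoeff F x) (ψ₁ x, ψ₂ x) ∧
        wirtinger ψ₂ x + potentialFst F x * ψ₁ x = 0 ∧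
        -wirtingerBar ψ₁ x + potentialSnd F x * ψ₂ x = 0 ∧
        (ψ₁ x ≠ 0 → U x = potentialFst F x) ∧ (ψ₂ x ≠ 0 → V x = potentialSnd F x) := by
    intro w hw
    obtain ⟨Ω, hΩ, hwΩ, hΩD, ψ₁, ψ₂, c1, c2, hψ⟩ := h.exists_local_spinor hw
    refine ⟨Ω, hΩ, hwΩ, hΩD, ψ₁, ψ₂, fun x hx => ?_⟩
    have e1 := h0.2.2 Ω hΩ hΩD ψ₁ ψ₂ c1 c2 hψ x hx
    have e2 := hUV.2.2 Ω hΩ hΩD ψ₁ ψ₂ c1 c2 hψ x hx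
    refine ⟨hψ x hx, e1.1, e1.2, fun hn => ?_, fun hn => ?_⟩
    · exact mul_right_cancel₀ hn (add_left_cancel (e2.1.trans e1.1.symm))
    · exact mul_right_cancel₀ hn (add_left_cancel (e2.2.trans e1.2.symm))
  refine ⟨eqOn_of_ne_subset_empty h.isOpen hUV.1 h0.1 fun O hO hOD hne => ?_,
    eqOn_of_ne_subset_empty h.isOpen hUV.2.1 h0.2.1 fun O hO hOD hne => ?_⟩
  · by_contra hO0
    obtain ⟨w, hwO⟩ := Set.nonempty_iff_ne_empty.2 hO0
    obtain ⟨Ω, hΩ, hwΩ, hΩD, ψ₁, ψ₂, hψ⟩ := hw w (hOD hwO)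
    have hz : ψ₁ =ᶠ[nhds w] fun _ => 0 := by
      filter_upwards [hO.mem_nhds hwO, hΩ.mem_nhds hwΩ] with x hx hxΩ
      by_contra hn
      exact hne x hx ((hψ x hxΩ).2.2.2.1 hn)
    have hs := isSpinor_iff.1 (hψ w hwΩ).1
    have hP : sqFst F w = 0 := by rw [← hs.1, hz.self_of_nhds]; simp
    have hQ := (h.sqFst_ne_zero_or (hOD hwO)).resolve_left (not_not.2 hP)
    have e := (hψ w hwΩ).2.2.1
    rw [wirtingerBar_congr hz] at e
    have h2 : ψ₂ w ≠ 0 := by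
      intro h2
      exact hQ (by rw [← hs.2.1, h2]; simp)
    -- With `ψ₁ = 0` near `w` the second equation reads `Vψ₂ = 0`, but the imaginary part of
    -- `potentialSnd` at `w` is `-½|ψ₂|²`, which is nonzero.
    have hV : potentialSnd F w = 0 := by simpa [wirtingerBar, h2] using e
    have := congrArg Complex.im hV
    rw [potentialSnd, hP] at this
    norm_num [Complex.div_im] at this
    exact hQ this
  · by_contra hO0
    obtain ⟨w, hwO⟩ := Set.nonempty_iff_ne_empty.2 hO0
    obtain ⟨Ω, hΩ, hwΩ, hΩD, ψ₁, ψ₂, hψ⟩ := hw w (hOD hwO)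
    have hz : ψ₂ =ᶠ[nhds w] fun _ => 0 := by
      filter_upwards [hO.mem_nhds hwO, hΩ.mem_nhds hwΩ] with x hx hxΩ
      by_contra hn
      exact hne x hx ((hψ x hxΩ).2.2.2.2 hn)
    have hs := isSpinor_iff.1 (hψ w hwΩ).1
    have hQ : sqSnd F w = 0 := by rw [← hs.2.1, hz.self_of_nhds]; simp
    have hP := (h.sqFst_ne_zero_or (hOD hwO)).resolve_right (not_not.2 hQ)
    have e := (hψ w hwΩ).2.1
    rw [wirtinger, hz.fderiv_eq] at e
    have h1 : ψ₁ w ≠ 0 := by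
      intro h1
      exact hP (by rw [← hs.1, h1]; simp)
    have hU : potentialFst F w = 0 := by simpa [h1] using e
    have := congrArg Complex.im hU
    rw [potentialFst, hQ] at this
    norm_num [Complex.div_im] at this
    exact hP this

/-! ### The product of the potentials. -/

/-- The real part of the product of the potentials. -/
def energyDensity (F : ℂ → SLTilde) (z : ℂ) : ℝ :=
  meanCurvature F z ^ 2 / 4 * (‖sqFst F z‖ + ‖sqSnd F z‖) ^ 2 -
    (1 / 2 * ‖sqFst F z‖ - 3 / 4 * ‖sqSnd F z‖) * (3 / 4 * ‖sqFst F z‖ - 1 / 2 * ‖sqSnd F z‖)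

/-- The divergence of the third component of the velocity. -/
def divVertical (F : ℂ → SLTilde) (z : ℂ) : ℝ :=
  fderiv ℝ (fun x => velocity F x 1 2) z 1 +
    fderiv ℝ (fun x => velocity F x Complex.I 2) z Complex.I

/-- The imaginary part is `(5/8) H (|ψ₁|⁴ - |ψ₂|⁴)`. The third component of `f_x × f_y` equals
`|ψ₂|⁴ - |ψ₁|⁴`, so the third equation of `ConformalOn.laplacian_eq` gives `divVertical = 2H(|ψ₂|⁴ -
|ψ₁|⁴)`; this is the origin of `-5/16`. -/
lemma ConformalOn.potential_mul (h : ConformalOn F D) (hz : z ∈ D) :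
    potentialFst F z * potentialSnd F z =
      energyDensity F z + ((-(5 / 16) * divVertical F z : ℝ) : ℂ) * Complex.I := by
  obtain ⟨ψ, hψ⟩ : ∃ ψ, IsSpinor (zCoeff F z) ψ := ⟨_, h.isSpinor_spinor hz⟩
  have hA : ∀ k, (velocity F z 1 k : ℂ) = zCoeff F z k + (starRingEnd ℂ) (zCoeff F z k) := by
    intro k
    simp [zCoeff, Complex.conj_ofNat]
    ring
  have hB : ∀ k, (velocity F z Complex.I k : ℂ) =
      Complex.I * (zCoeff F z k - (starRingEnd ℂ) (zCoeff F z k)) := by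
    intro k
    simp [zCoeff, Complex.conj_ofNat]
    linear_combination (velocity F z Complex.I k : ℂ) * Complex.I_sq
  have n1 : (‖sqFst F z‖ : ℂ) = ψ.1 * (starRingEnd ℂ) ψ.1 := by
    rw [← hψ.norm_fst_sq, Complex.mul_conj, Complex.normSq_eq_norm_sq]
  have n2 : (‖sqSnd F z‖ : ℂ) = ψ.2 * (starRingEnd ℂ) ψ.2 := by
    rw [← hψ.norm_snd_sq, Complex.mul_conj, Complex.normSq_eq_norm_sq]
  rw [divVertical, (h.laplacian_eq hz).2.2, potentialFst, potentialSnd, energyDensity]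
  push_cast
  simp only [hA, hB, n1, n2, hψ.1, hψ.2.1, map_mul, map_add, map_sub, map_pow, map_div₀,
    map_ofNat, map_one, Complex.conj_I, Complex.conj_conj]
  have hI := Complex.I_sq
  clear hA hB n1 n2 hψ h
  generalize (starRingEnd ℂ) ψ.1 = x' at *
  generalize (starRingEnd ℂ) ψ.2 = y' at *
  generalize ψ.1 = x at *
  generalize ψ.2 = y at *
  generalize (meanCurvature F z : ℂ) = H at *
  generalize Complex.I = i at *
  grind

/-! ### From the coordinates `(θ, b)` to matrices: smoothness and the immersion condition in charts.
-/

/-- The global coordinates of an element of `SL̃₂`. -/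
def coords (g : SLTilde) : ℝ × ℂ := g

lemma b_eq_proj (g : SLTilde) : b g = ((((proj g).1 0 0 - (proj g).1 1 1 : ℝ) : ℂ) +
    (((proj g).1 1 0 + (proj g).1 0 1 : ℝ) : ℂ) * Complex.I) * (1 / 2) := by
  rw [← coeffB_proj, coeffB, Complex.mk_eq_add_mul_I]
  push_cast
  ring

lemma a_eq_proj (g : SLTilde) : a g = ((((proj g).1 0 0 + (proj g).1 1 1 : ℝ) : ℂ) +
    (((proj g).1 1 0 - (proj g).1 0 1 : ℝ) : ℂ) * Complex.I) * (1 / 2) := by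
  rw [← coeffA_proj, coeffA, Complex.mk_eq_add_mul_I]
  push_cast
  ring

lemma a_eq_of_b_eq {g h : SLTilde} {t : ℝ} (hb : h.b = g.b) (ht : h.theta = g.theta + t) :
    h.a = g.a * Complex.exp (t * Complex.I) := by
  rw [a, a, hb, ht, mul_assoc, ← Complex.exp_add]
  congr 2
  push_cast
  ring

lemma contDiff_proj (i j : Fin 2) : ContDiff ℝ ω (fun g : ℝ × ℂ => (proj g).1 i j) := by
  have ha := contDiff_a
  have hb := contDiff_b
  have har := Complex.reCLM.contDiff.comp ha
  have hai := Complex.imCLM.contDiff.comp ha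
  have hbr := Complex.reCLM.contDiff.comp hb
  have hbi := Complex.imCLM.contDiff.comp hb
  fin_cases i <;> fin_cases j
  · exact har.add hbr
  · exact hbi.sub hai
  · exact hai.add hbi
  · exact har.sub hbr

lemma SmoothOn.of_contDiffOn (hD : IsOpen D)
    (hF : ContDiffOn ℝ ∞ (fun w => coords (F w)) D) : SmoothOn F D :=
  ⟨hD, fun i j => ((contDiff_proj i j).of_le le_top).comp_contDiffOn hF⟩

/-- The coefficient `a` is an immersion along the circle direction. -/
lemma fderiv_a_apply (g : ℝ × ℂ) (t : ℝ) :
    fderiv ℝ (fun g : ℝ × ℂ => a g) g (t, 0) = a g * (t * Complex.I) := by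
  have h1 : HasFDerivAt (fun g : ℝ × ℂ => a g) (fderiv ℝ (fun g : ℝ × ℂ => a g) g) g :=
    (contDiff_a.differentiable (by simp) g).hasFDerivAt
  have h2 : HasDerivAt (fun s : ℝ => g + s • ((t, 0) : ℝ × ℂ)) ((t, 0) : ℝ × ℂ) 0 := by
    simpa using ((hasDerivAt_id (0 : ℝ)).smul_const ((t, 0) : ℝ × ℂ)).const_add g
  have h3 := HasFDerivAt.comp_hasDerivAt (0 : ℝ) (l := fun g : ℝ × ℂ => a g)
    (by simpa using h1) h2
  have h4 : HasDerivAt (fun s : ℝ => a g * Complex.exp ((s : ℂ) * (t * Complex.I)))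
      (a g * (t * Complex.I)) 0 := by
    have h5 := ((Complex.ofRealCLM.hasDerivAt (x := (0 : ℝ))).mul_const
      ((t : ℂ) * Complex.I)).cexp.const_mul (a g)
    simpa using h5
  have h6 : ((fun g : ℝ × ℂ => a g) ∘ fun s : ℝ => g + s • ((t, 0) : ℝ × ℂ)) =
      fun s : ℝ => a g * Complex.exp ((s : ℂ) * (t * Complex.I)) := by
    ext s
    have e1 : b (g + s • ((t, 0) : ℝ × ℂ)) = b g := by
      change g.2 + s • (0 : ℂ) = g.2
      simp
    have e2 : theta (g + s • ((t, 0) : ℝ × ℂ)) = theta g + s * t := rfl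
    refine (a_eq_of_b_eq e1 e2).trans ?_
    push_cast
    rw [mul_assoc]
  rw [h6] at h3
  exact h3.unique h4

/-- The velocity records only the traceless part of `F⁻¹dF`; the derivative of `det = 1` supplies
the vanishing of the trace, and `F` is invertible. -/
lemma SmoothOn.fderiv_entry_eq_zero (h : SmoothOn F D) (hz : z ∈ D) {u : ℂ}
    (hu : velocity F z u = 0) (i j : Fin 2) : fderiv ℝ (entry F i j) z u = 0 := by
  have h0 := velocity_zero_eq F z u
  have h1 := velocity_one_eq F z u
  have h2 := velocity_two_eq F z u
  have h3 := h.det_deriv hz u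
  have hd := entry_det F z
  rw [hu] at h0 h1 h2
  simp only [Pi.zero_apply] at h0 h1 h2
  generalize entry F 0 0 z = p at *
  generalize entry F 0 1 z = q at *
  generalize entry F 1 0 z = r at *
  generalize entry F 1 1 z = s at *
  fin_cases i <;> fin_cases j <;> dsimp only [Fin.zero_eta, Fin.mk_one] <;> grind

/-- The covering map to matrices is an immersion: the matrix determines `b` and `a`, and `a` detects
motion in `θ` when `b` is stationary. -/
lemma SmoothOn.fderiv_eq_zero (hD : IsOpen D)
    (hF : ContDiffOn ℝ ∞ (fun w => coords (F w)) D)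
    (hz : z ∈ D) {u : ℂ} (hu : velocity F z u = 0) : fderiv ℝ (fun w => coords (F w)) z u = 0 := by
  have hs := SmoothOn.of_contDiffOn hD hF
  have he := hs.fderiv_entry_eq_zero hz hu
  have hE := fun i j => ((hs.contDiffAt hz i j).differentiableAt (by simp)).hasFDerivAt
  have hF' := ((hF.contDiffAt (hD.mem_nhds hz)).differentiableAt (by simp)).hasFDerivAt
  have hofr : ∀ {x : ℂ → ℝ} {x' : ℂ →L[ℝ] ℝ}, HasFDerivAt x x' z →
      HasFDerivAt (fun w => (x w : ℂ)) (Complex.ofRealCLM.comp x') z :=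
    fun hx => Complex.ofRealCLM.hasFDerivAt.comp z hx
  have hb : fderiv ℝ (fun w => b (F w)) z u = 0 := by
    have h1 := ((hofr ((hE 0 0).fun_sub (hE 1 1))).fun_add
      ((hofr ((hE 1 0).fun_add (hE 0 1))).mul_const Complex.I)).mul_const (1 / 2 : ℂ)
    have h2 : (fun w => b (F w)) = fun w => (((entry F 0 0 w - entry F 1 1 w : ℝ) : ℂ) +
        ((entry F 1 0 w + entry F 0 1 w : ℝ) : ℂ) * Complex.I) * (1 / 2) := by
      exact funext fun w => b_eq_proj (F w)
    rw [h2, h1.fderiv]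
    simp [he]
  have ha : fderiv ℝ (fun w => a (F w)) z u = 0 := by
    have h1 := ((hofr ((hE 0 0).fun_add (hE 1 1))).fun_add
      ((hofr ((hE 1 0).fun_sub (hE 0 1))).mul_const Complex.I)).mul_const (1 / 2 : ℂ)
    have h2 : (fun w => a (F w)) = fun w => (((entry F 0 0 w + entry F 1 1 w : ℝ) : ℂ) +
        ((entry F 1 0 w - entry F 0 1 w : ℝ) : ℂ) * Complex.I) * (1 / 2) := by
      exact funext fun w => a_eq_proj (F w)
    rw [h2, h1.fderiv]
    simp [he]
  have hb2 : (fderiv ℝ (fun w => coords (F w)) z u).2 = 0 := by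
    have h1 : HasFDerivAt (fun w => b (F w)) ((ContinuousLinearMap.snd ℝ ℝ ℂ).comp (fderiv ℝ (fun w => coords (F w)) z))
      z := (ContinuousLinearMap.snd ℝ ℝ ℂ).hasFDerivAt.comp z hF'
    rw [h1.fderiv] at hb
    exact hb
  have h1 : HasFDerivAt (fun w => a (F w)) ((fderiv ℝ (fun g : ℝ × ℂ => a g) (coords (F z))).comp
      (fderiv ℝ (fun w => coords (F w)) z)) z :=
    HasFDerivAt.comp (g := fun g : ℝ × ℂ => a g) z
      (contDiff_a.differentiable (by simp) (coords (F z))).hasFDerivAt hF'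
  rw [h1.fderiv] at ha
  have h2 : fderiv ℝ (fun w => coords (F w)) z u = ((fderiv ℝ (fun w => coords (F w)) z u).1, 0) := Prod.ext rfl hb2
  rw [ContinuousLinearMap.comp_apply, h2, fderiv_a_apply] at ha
  have h3 := (mul_eq_zero.1 ha).resolve_left (a_ne_zero _)
  rw [h2]
  simpa using h3

end SLTilde

section Immersion

open SLTilde

variable {M : Type*} [TopologicalSpace M] [ChartedSpace ℂ M] [IsManifold 𝓘(ℂ) ω M]

lemma IsConformalImmersion.contDiffOn_comp_symm {f : M → SLTilde} (hf : IsConformalImmersion f)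
    {e : OpenPartialHomeomorph M ℂ} (he : e ∈ atlas ℂ M) :
    ContDiffOn ℝ ∞ (fun w => coords (f (e.symm w))) e.target := by
  have := isManifold_real_of_complex M
  have h1 := contMDiffOn_symm_of_mem_maximalAtlas (I := 𝓘(ℝ, ℂ)) (n := ∞)
    (IsManifold.subset_maximalAtlas he)
  have h2 := hf.smooth.comp_contMDiffOn h1
  exact contMDiffOn_iff_contDiffOn.1 h2

lemma IsConformalImmersion.conformalOn {f : M → SLTilde} (hf : IsConformalImmersion f)
    {e : OpenPartialHomeomorph M ℂ} (he : e ∈ atlas ℂ M) :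
    ConformalOn (f ∘ e.symm) e.target where
  toSmoothOn := SmoothOn.of_contDiffOn e.open_target (hf.contDiffOn_comp_symm he)
  sq_eq z hz := (hf.conformal e he z hz).1
  orthogonal z hz := (hf.conformal e he z hz).2
  ne_zero z hz hv := by
    have := isManifold_real_of_complex M
    have : IsManifold 𝓘(ℝ, ℂ) 1 M := IsManifold.of_le (n := ∞) (by simp)
    -- A vanishing velocity along `1` would put `1` in the kernel of the differential of `f ∘
    -- e.symm`, a composition of two injective maps.
    have h0 : fderiv ℝ (fun w => coords (f (e.symm w))) z 1 = 0 :=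
      SmoothOn.fderiv_eq_zero e.open_target (hf.contDiffOn_comp_symm he) hz hv
    have hm := mdifferentiable_of_mem_atlas (I := 𝓘(ℝ, ℂ)) he
    have h1 : MDifferentiableAt 𝓘(ℝ, ℂ) 𝓘(ℝ, ℝ × ℂ) f (e.symm z) :=
      hf.smooth.mdifferentiableAt (by simp)
    have h2 := mfderiv_comp z h1 (hm.mdifferentiableAt_symm hz)
    have h3 : mfderiv 𝓘(ℝ, ℂ) 𝓘(ℝ, ℝ × ℂ) (f ∘ e.symm) z =
      fderiv ℝ (fun w => coords (f (e.symm w))) z := mfderiv_eq_fderiv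
    have h4 : mfderiv 𝓘(ℝ, ℂ) 𝓘(ℝ, ℝ × ℂ) (f ∘ e.symm) z (1 : ℂ) = 0 := by
      rw [h3]; exact h0
    rw [h2] at h4
    have h5 := hf.immersion (e.symm z) (h4.trans (map_zero _).symm)
    have h6 := hm.symm.mfderiv_injective hz (h5.trans (map_zero _).symm)
    exact one_ne_zero (α := ℂ) h6

end Immersion

/-! ### Integrals of compactly supported functions on plane domains. -/

open MeasureTheory

/-- A function continuous on an open set and supported in a compact subset is integrable. -/
lemma integrableOn_of_zero_off_compact {E : Type*} [NormedAddCommGroup E] {D K : Set ℂ}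
    (hD : IsOpen D) (hK : IsCompact K) (hKD : K ⊆ D) {h : ℂ → E} (hc : ContinuousOn h D)
    (h0 : ∀ z ∈ D \ K, h z = 0) : IntegrableOn h D :=
  ((hc.mono hKD).integrableOn_compact hK).of_forall_sdiff_eq_zero hD.measurableSet h0

/-- The integral of a directional derivative of a compactly supported function vanishes. -/
lemma integral_fderiv_eq_zero_of_zero_off_compact {D K : Set ℂ}
    (hD : IsOpen D) (hK : IsCompact K) (hKD : K ⊆ D) {h : ℂ → ℝ} (hc : ContDiffOn ℝ 1 h D)
    (h0 : ∀ z ∈ D \ K, h z = 0) (v : ℂ) :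
    ∫ z in D, fderiv ℝ h z v = 0 := by
  have hev : ∀ z ∈ D, D.indicator h =ᶠ[nhds z] h := fun z hz => by
    filter_upwards [hD.mem_nhds hz] with w hw
    exact Set.indicator_of_mem hw h
  have hoff : ∀ z ∉ K, D.indicator h =ᶠ[nhds z] fun _ => 0 := fun z hz => by
    filter_upwards [hK.isClosed.isOpen_compl.mem_nhds hz] with w hw
    by_cases hwD : w ∈ D
    · rw [Set.indicator_of_mem hwD, h0 w ⟨hwD, hw⟩]
    · exact Set.indicator_of_notMem hwD h
  have hsm : ContDiff ℝ 1 (D.indicator h) := contDiff_iff_contDiffAt.2 fun z => by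
    by_cases hz : z ∈ D
    · exact (hc.contDiffAt (hD.mem_nhds hz)).congr_of_eventuallyEq (hev z hz)
    · exact contDiffAt_const.congr_of_eventuallyEq (hoff z fun hk => hz (hKD hk))
  have hfd : ∀ z ∉ K, fderiv ℝ (D.indicator h) z v = 0 := fun z hz => by
    rw [(hoff z hz).fderiv_eq]
    simp
  have hcs : HasCompactSupport (D.indicator h) := HasCompactSupport.intro hK fun z hz =>
    (hoff z hz).self_of_nhds
  have hcs' : HasCompactSupport (fun z => fderiv ℝ (D.indicator h) z v) :=
    HasCompactSupport.intro hK hfd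
  have hi := (hsm.continuous).integrable_of_hasCompactSupport hcs (μ := volume)
  have hi' := ((hsm.continuous_fderiv (by simp)).clm_apply continuous_const
    ).integrable_of_hasCompactSupport hcs' (μ := volume)
  -- Integration by parts against the constant function `1`, applied to the extension of `h` by
  -- zero.
  have key := integral_mul_fderiv_eq_neg_fderiv_mul_of_integrable (μ := volume)
    (f := fun _ : ℂ => (1 : ℝ)) (g := D.indicator h) (v := v) (by simp) (by simpa using hi')
    (by simpa using hi) (fun _ _ => differentiableAt_const _)
    (fun x _ => hsm.differentiable (by simp) x)
  simp only [one_mul, fderiv_fun_const, Pi.zero_apply, _root_.zero_apply, zero_mul,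
    integral_zero, neg_zero] at key
  rw [← key, ← setIntegral_eq_integral_of_forall_compl_eq_zero (s := D)
    fun z hz => hfd z fun hk => hz (hKD hk)]
  refine setIntegral_congr_fun hD.measurableSet fun z hz => ?_
  simp only [(hev z hz).fderiv_eq]

/-! ### The flux, its change of charts and integration by parts. -/

/-- The pairing of the differential of `r` with the third component of the velocity of `F`. -/
def SLTilde.flux (r : ℂ → ℝ) (F : ℂ → SLTilde) (z : ℂ) : ℝ :=
  fderiv ℝ r z 1 * velocity F z 1 2 + fderiv ℝ r z Complex.I * velocity F z Complex.I 2

/-- The Jacobian of a holomorphic transition map; it matches the factor by which the flux scales. -/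
lemma det_smul_one_eq_normSq (c : ℂ) : (c • (1 : ℂ →L[ℝ] ℂ)).det = Complex.normSq c := by
  rw [← Algebra.norm_complex_apply, Algebra.norm_apply]
  rfl

namespace SLTilde

lemma velocity_comp {F : ℂ → SLTilde} {D : Set ℂ} {φ : ℂ → ℂ} {z c : ℂ} {F' : ℂ → SLTilde}
    (hF : SmoothOn F D) (hφ : HasDerivAt φ c z) (hz : φ z ∈ D)
    (he : F' =ᶠ[nhds z] F ∘ φ) (u : ℂ) (k : Fin 3) :
    velocity F' z u k = velocity F (φ z) (c * u) k := by
  have hent : ∀ i j, entry F' i j z = entry F i j (φ z) := fun i j => by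
    simp only [entry, he.self_of_nhds, Function.comp_apply]
  have hder : ∀ i j, fderiv ℝ (entry F' i j) z u = fderiv ℝ (entry F i j) (φ z) (c * u) := by
    intro i j
    have h1 : entry F' i j =ᶠ[nhds z] entry F i j ∘ φ := by
      filter_upwards [he] with w hw
      simp only [entry, hw, Function.comp_apply]
    have h2 := (((hF.contDiffAt hz i j).differentiableAt (by simp)).hasFDerivAt).comp z
      hφ.complexToReal_fderiv
    rw [h1.fderiv_eq, h2.fderiv]
    simp
  fin_cases k
  · simp only [Fin.zero_eta, velocity_zero_eq, hent, hder]
  · simp only [Fin.mk_one, velocity_one_eq, hent, hder]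
  · simp only [Fin.reduceFinMk, velocity_two_eq, hent, hder]

/-- Conformal invariance of the flux. -/
lemma flux_comp {F F' : ℂ → SLTilde} {D : Set ℂ} {φ : ℂ → ℂ} {z c : ℂ} {r r' : ℂ → ℝ}
    (hF : SmoothOn F D) (hφ : HasDerivAt φ c z) (hz : φ z ∈ D)
    (he : F' =ᶠ[nhds z] F ∘ φ) (hr : DifferentiableAt ℝ r (φ z))
    (her : r' =ᶠ[nhds z] r ∘ φ) : flux r' F' z = Complex.normSq c * flux r F (φ z) := by
  have h2 := hr.hasFDerivAt.comp z hφ.complexToReal_fderiv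
  rw [flux, flux, velocity_comp hF hφ hz he, velocity_comp hF hφ hz he, her.fderiv_eq, h2.fderiv]
  simp only [ContinuousLinearMap.comp_apply, _root_.smul_apply, one_apply_eq_self,
    smul_eq_mul]
  rw [fderiv_apply_eq _ (c * 1), fderiv_apply_eq _ (c * Complex.I), velocity_eq _ _ (c * 1),
    velocity_eq _ _ (c * Complex.I), Complex.normSq_apply]
  simp
  ring

end SLTilde

section Surface

open SLTilde

variable {M : Type*} [TopologicalSpace M]
  {f : M → SLTilde} {e e' : OpenPartialHomeomorph M ℂ} {ρ σ : M → ℝ}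

lemma isCompact_image_tsupport [CompactSpace M] (hρ : tsupport ρ ⊆ e.source) : IsCompact (e '' tsupport ρ) :=
  (isClosed_tsupport ρ).isCompact.image_of_continuousOn (e.continuousOn.mono hρ)

lemma image_tsupport_subset (hρ : tsupport ρ ⊆ e.source) : e '' tsupport ρ ⊆ e.target := by
  rintro _ ⟨x, hx, rfl⟩
  exact e.map_source (hρ hx)

lemma symm_notMem_tsupport {z : ℂ} (hz : z ∈ e.target \ e '' tsupport ρ) :
    e.symm z ∉ tsupport ρ := fun h => hz.2 ⟨_, h, e.right_inv hz.1⟩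

lemma eventually_comp_symm_eq_zero {z : ℂ} (hz : z ∈ e.target) (h : e.symm z ∉ tsupport ρ) :
    ρ ∘ e.symm =ᶠ[nhds z] fun _ => 0 := by
  have h1 : ∀ᶠ x in nhds (e.symm z), x ∉ tsupport ρ :=
    (isClosed_tsupport ρ).isOpen_compl.mem_nhds h
  filter_upwards [(e.continuousAt_symm hz).eventually h1] with w hw
  exact image_eq_zero_of_notMem_tsupport (f := ρ) hw

lemma flux_eq_zero {F : ℂ → SLTilde} {z : ℂ} (hz : z ∈ e.target) (h : e.symm z ∉ tsupport ρ) :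
    flux (ρ ∘ e.symm) F z = 0 := by
  simp [flux, (eventually_comp_symm_eq_zero hz h).fderiv_eq]

variable [ChartedSpace ℂ M] [IsManifold 𝓘(ℂ) ω M]

lemma contDiffOn_comp_symm (he : e ∈ atlas ℂ M) (hρ : ContMDiff 𝓘(ℝ, ℂ) 𝓘(ℝ, ℝ) ∞ ρ) :
    ContDiffOn ℝ ∞ (ρ ∘ e.symm) e.target := by
  have := isManifold_real_of_complex M
  have h1 := contMDiffOn_symm_of_mem_maximalAtlas (I := 𝓘(ℝ, ℂ)) (n := ∞)
    (IsManifold.subset_maximalAtlas he)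
  exact contMDiffOn_iff_contDiffOn.1 (hρ.comp_contMDiffOn h1)

lemma differentiableAt_transition (he : e ∈ atlas ℂ M) (he' : e' ∈ atlas ℂ M) {z : ℂ}
    (hz : z ∈ (e.symm.trans e').source) : DifferentiableAt ℂ (e.symm.trans e') z := by
  have h := (contDiffGroupoid ω 𝓘(ℂ)).compatible he he'
  rw [contDiffGroupoid, mem_groupoid_of_pregroupoid] at h
  have h2 : ContDiffOn ℂ ω (e.symm.trans e') (e.symm.trans e').source := by
    simpa [contDiffPregroupoid] using h.1
  exact (h2.contDiffAt ((e.symm.trans e').open_source.mem_nhds hz)).differentiableAt (by simp)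

lemma continuousOn_flux (hf : IsConformalImmersion f) (he : e ∈ atlas ℂ M)
    (hρ : ContMDiff 𝓘(ℝ, ℂ) 𝓘(ℝ, ℝ) ∞ ρ) :
    ContinuousOn (flux (ρ ∘ e.symm) (f ∘ e.symm)) e.target := by
  intro z hz
  have hF := hf.conformalOn he
  have h1 := fun v => ((((contDiffOn_comp_symm he hρ).contDiffAt
    (e.open_target.mem_nhds hz)).fderiv_right (m := ∞) (by simp)).clm_apply
      (contDiffAt_const (c := v))).continuousAt
  have h2 := fun v => (hF.contDiffAt_velocity hz v 2).continuousAt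
  exact (((h1 1).mul (h2 1)).add ((h1 Complex.I).mul (h2 Complex.I))).continuousWithinAt

lemma continuousOn_divVertical (hf : IsConformalImmersion f) (he : e ∈ atlas ℂ M) :
    ContinuousOn (divVertical (f ∘ e.symm)) e.target := fun _ hz =>
  ((((hf.conformalOn he).contDiffAt_fderiv_velocity hz 1 1 2).continuousAt).add
    (((hf.conformalOn he).contDiffAt_fderiv_velocity hz Complex.I Complex.I 2
      ).continuousAt)).continuousWithinAt

lemma continuousOn_energyDensity (hf : IsConformalImmersion f) (he : e ∈ atlas ℂ M) : ContinuousOn (energyDensity (f ∘ e.symm)) e.target := fun z hz => by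
  have hF := hf.conformalOn he
  have c0 := hF.continuousAt_meanCurvature hz
  have c1 := (hF.contDiffAt_sqFst hz).continuousAt.norm
  have c2 := (hF.contDiffAt_sqSnd hz).continuousAt.norm
  exact ((((c0.pow 2).div_const 4).mul ((c1.add c2).pow 2)).sub
    (((continuousAt_const.mul c1).sub (continuousAt_const.mul c2)).mul
      ((continuousAt_const.mul c1).sub (continuousAt_const.mul c2)))).continuousWithinAt

/-- The integral of the flux does not depend on the chart. -/
lemma integral_mul_flux_eq (hf : IsConformalImmersion f) (he : e ∈ atlas ℂ M)
    (he' : e' ∈ atlas ℂ M) (hρ : ContMDiff 𝓘(ℝ, ℂ) 𝓘(ℝ, ℝ) ∞ ρ) (hs : tsupport ρ ⊆ e.source)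
    (hs' : tsupport σ ⊆ e'.source) :
    ∫ z in e.target, σ (e.symm z) * flux (ρ ∘ e.symm) (f ∘ e.symm) z =
      ∫ z in e'.target, σ (e'.symm z) * flux (ρ ∘ e'.symm) (f ∘ e'.symm) z := by
  have hφ := fun z hz => (differentiableAt_transition he he' (z := z) hz).hasDerivAt
  have hsrc : (e.symm.trans e').source ⊆ e.target := fun z hz => by
    rw [OpenPartialHomeomorph.trans_source] at hz
    exact hz.1
  have htgt : (e.symm.trans e').target ⊆ e'.target := fun z hz => by
    rw [OpenPartialHomeomorph.trans_target] at hz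
    exact hz.1
  -- Both integrals shrink to the overlap of the charts: off it, `σ` vanishes on the side of `e`,
  -- and the flux of `ρ` vanishes on the side of `e'`.
  rw [setIntegral_eq_of_subset_of_forall_sdiff_eq_zero e.open_target.measurableSet hsrc,
    setIntegral_eq_of_subset_of_forall_sdiff_eq_zero e'.open_target.measurableSet htgt,
    ← (e.symm.trans e').image_source_eq_target,
    integral_image_eq_integral_abs_det_fderiv_smul volume
      (e.symm.trans e').open_source.measurableSet
      (fun z hz => (hφ z hz).complexToReal_fderiv.hasFDerivWithinAt)
      (e.symm.trans e').injOn]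
  · refine setIntegral_congr_fun (e.symm.trans e').open_source.measurableSet fun z hz => ?_
    have hzt : (e.symm.trans e') z ∈ e'.target := htgt ((e.symm.trans e').map_source hz)
    have hev : ∀ᶠ w in nhds z, e'.symm ((e.symm.trans e') w) = e.symm w := by
      filter_upwards [(e.symm.trans e').open_source.mem_nhds hz] with w hw
      rw [OpenPartialHomeomorph.trans_source] at hw
      exact e'.left_inv hw.2
    have hfl := flux_comp (hf.conformalOn he').toSmoothOn (hφ z hz) hzt
      (F' := f ∘ e.symm) (r := ρ ∘ e'.symm) (r' := ρ ∘ e.symm)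
      (hev.mono fun w hw => by simp only [Function.comp_apply] at hw ⊢; rw [hw])
      (((contDiffOn_comp_symm he' hρ).contDiffAt
        (e'.open_target.mem_nhds hzt)).differentiableAt (by simp))
      (hev.mono fun w hw => by simp only [Function.comp_apply] at hw ⊢; rw [hw])
    simp only [hfl, det_smul_one_eq_normSq, abs_of_nonneg (Complex.normSq_nonneg _), smul_eq_mul,
      hev.self_of_nhds]
    ring
  · intro z hz
    have h1 : e'.symm z ∉ e.source := fun h => hz.2 (by
      rw [OpenPartialHomeomorph.trans_target]
      exact ⟨hz.1, h⟩)
    rw [flux_eq_zero hz.1 fun h => h1 (hs h), mul_zero]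
  · intro z hz
    have h1 : e.symm z ∉ e'.source := fun h => hz.2 (by
      rw [OpenPartialHomeomorph.trans_source]
      exact ⟨hz.1, h⟩)
    rw [image_eq_zero_of_notMem_tsupport fun h => h1 (hs' h), zero_mul]

variable [CompactSpace M]

lemma integrableOn_mul_of_tsupport_subset {E : Type*} [NormedAddCommGroup E] [NormedSpace ℝ E]
    (he : e ∈ atlas ℂ M) (hρ : ContMDiff 𝓘(ℝ, ℂ) 𝓘(ℝ, ℝ) ∞ ρ) (hs : tsupport ρ ⊆ e.source)
    {k : ℂ → E} (hk : ContinuousOn k e.target) :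
    IntegrableOn (fun z => ρ (e.symm z) • k z) e.target :=
  integrableOn_of_zero_off_compact e.open_target (isCompact_image_tsupport hs)
    (image_tsupport_subset hs) ((contDiffOn_comp_symm he hρ).continuousOn.smul hk)
    fun z hz => by
      rw [image_eq_zero_of_notMem_tsupport (symm_notMem_tsupport hz), zero_smul]

lemma integrableOn_mul_flux (hf : IsConformalImmersion f) (he : e ∈ atlas ℂ M)
    (hρ : ContMDiff 𝓘(ℝ, ℂ) 𝓘(ℝ, ℝ) ∞ ρ) (hs : tsupport ρ ⊆ e.source) {k : ℂ → ℝ}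
    (hk : ContinuousOn k e.target) :
    IntegrableOn (fun z => k z * flux (ρ ∘ e.symm) (f ∘ e.symm) z) e.target :=
  integrableOn_of_zero_off_compact e.open_target (isCompact_image_tsupport hs)
    (image_tsupport_subset hs) (hk.mul (continuousOn_flux hf he hρ))
    fun z hz => by
      rw [flux_eq_zero hz.1 (symm_notMem_tsupport hz), mul_zero]

/-- Integration by parts in a chart. -/
lemma integral_mul_divVertical (hf : IsConformalImmersion f) (he : e ∈ atlas ℂ M)
    (hρ : ContMDiff 𝓘(ℝ, ℂ) 𝓘(ℝ, ℝ) ∞ ρ) (hs : tsupport ρ ⊆ e.source) :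
    ∫ z in e.target, ρ (e.symm z) * divVertical (f ∘ e.symm) z =
      -∫ z in e.target, flux (ρ ∘ e.symm) (f ∘ e.symm) z := by
  have hF := hf.conformalOn he
  have hr := contDiffOn_comp_symm he hρ
  have hv : ∀ v, ContDiffOn ℝ ∞ (fun z => velocity (f ∘ e.symm) z v 2) e.target :=
    fun v z hz => (hF.contDiffAt_velocity hz v 2).contDiffWithinAt
  have hI : ∀ v w, ∫ z in e.target, fderiv ℝ (fun z => (ρ ∘ e.symm) z *
      velocity (f ∘ e.symm) z v 2) z w = 0 := fun v w =>
    integral_fderiv_eq_zero_of_zero_off_compact e.open_target (isCompact_image_tsupport hs)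
      (image_tsupport_subset hs) ((hr.mul (hv v)).of_le (by simp)) (fun z hz => by
        simp only [Function.comp_apply]
        rw [image_eq_zero_of_notMem_tsupport (symm_notMem_tsupport hz), zero_mul]) w
  have hd : ∀ v w, ∀ z ∈ e.target, fderiv ℝ (fun z => (ρ ∘ e.symm) z *
      velocity (f ∘ e.symm) z v 2) z w = ρ (e.symm z) *
        fderiv ℝ (fun z => velocity (f ∘ e.symm) z v 2) z w +
      fderiv ℝ (ρ ∘ e.symm) z w * velocity (f ∘ e.symm) z v 2 := fun v w z hz => by
    have h1 := ((hr.contDiffAt (e.open_target.mem_nhds hz)).differentiableAt (by simp)).hasFDerivAt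
    have h2 := (hF.differentiableAt_velocity hz v 2).hasFDerivAt
    rw [(h1.fun_mul h2).fderiv]
    simp
    ring
  have i1 : ∀ v, IntegrableOn (fun z => fderiv ℝ (fun z => (ρ ∘ e.symm) z *
      velocity (f ∘ e.symm) z v 2) z v) e.target := fun v => by
    refine integrableOn_of_zero_off_compact e.open_target (isCompact_image_tsupport hs)
      (image_tsupport_subset hs) (fun z hz => ?_) fun z hz => ?_
    · have h3 := (hr.mul (hv v)).contDiffAt (e.open_target.mem_nhds hz)
      exact (((h3.fderiv_right (m := ∞) (by simp)).clm_apply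
        (contDiffAt_const (c := v))).continuousAt).continuousWithinAt
    · have h3 := symm_notMem_tsupport hz
      rw [hd v v z hz.1, image_eq_zero_of_notMem_tsupport h3,
        (eventually_comp_symm_eq_zero hz.1 h3).fderiv_eq]
      simp
  have i2 := integrableOn_mul_of_tsupport_subset he hρ hs (continuousOn_divVertical hf he)
  have i3 := integrableOn_mul_flux hf he hρ hs (continuousOn_const (c := (1 : ℝ)))
  simp only [smul_eq_mul, one_mul] at i2 i3
  rw [eq_neg_iff_add_eq_zero, ← integral_add i2 i3]
  have h0 := (integral_add (i1 1) (i1 Complex.I)).trans (congrArg₂ (· + ·) (hI 1 1)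
    (hI Complex.I Complex.I))
  rw [add_zero] at h0
  rw [← h0]
  refine setIntegral_congr_fun e.open_target.measurableSet fun z hz => ?_
  simp only [hd _ _ z hz, divVertical, flux]
  ring

end Surface

/-! ### Stokes' theorem by the partition of unity, and the energy. -/

section Partition

open SLTilde

variable {M : Type*} [TopologicalSpace M] [T2Space M] [CompactSpace M]
    [ChartedSpace ℂ M] [IsManifold 𝓘(ℂ) ω M] {f : M → SLTilde}

/-- By compactness only finitely many cutoffs are nonzero, so one finite index set serves everywhere
and sums commute with integrals. -/
lemma exists_finset_chartPartition (M : Type*) [TopologicalSpace M] [T2Space M] [CompactSpace M]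
    [ChartedSpace ℂ M] [IsManifold 𝓘(ℂ) ω M] : ∃ s : Finset M,
    (∀ p ∉ s, ∀ x, chartPartition M p x = 0) ∧ ∀ x, ∑ p ∈ s, chartPartition M p x = 1 := by
  have hfin := (chartPartition M).locallyFinite.finite_nonempty_of_compact
  have h0 : ∀ p ∉ hfin.toFinset, ∀ x, chartPartition M p x = 0 := fun p hp x => by
    by_contra h
    exact hp (hfin.mem_toFinset.2 ⟨x, h⟩)
  refine ⟨hfin.toFinset, h0, fun x => ?_⟩
  rw [← (chartPartition M).sum_eq_one (Set.mem_univ x)]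
  refine (finsum_eq_sum_of_support_subset _ fun p hp => ?_).symm
  by_contra h
  exact hp (h0 p h x)

lemma surfaceIntegral_eq_sum {E : Type*} [NormedAddCommGroup E] [NormedSpace ℝ E] {s : Finset M}
    (hs : ∀ p ∉ s, ∀ x, chartPartition M p x = 0) (h : OpenPartialHomeomorph M ℂ → ℂ → E) :
    surfaceIntegral h = ∑ p ∈ s, ∫ z in (chartAt ℂ p).target,
      chartPartition M p ((chartAt ℂ p).symm z) • h (chartAt ℂ p) z := by
  refine finsum_eq_sum_of_support_subset _ fun p hp => ?_
  by_contra hps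
  refine hp ?_
  simp [hs p hps]

/-- The integral of the divergence of the Killing field `e₃` along the surface vanishes. -/
theorem surfaceIntegral_divVertical (hf : IsConformalImmersion f) :
    (surfaceIntegral fun (e : OpenPartialHomeomorph M ℂ) z => divVertical (f ∘ e.symm) z) = 0 := by
  obtain ⟨s, hs0, hs1⟩ := exists_finset_chartPartition M
  have hsub := chartPartition_isSubordinate M
  have hsm : ∀ p : M, ContMDiff 𝓘(ℝ, ℂ) 𝓘(ℝ, ℝ) ∞ (chartPartition M p) :=
    fun p => (chartPartition M p).contMDiff
  have hat := fun p : M => chart_mem_atlas ℂ p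
  -- In the chart at `r` it is enough that one of the two cutoffs has its support inside that chart.
  have hint : ∀ p q r : M, (r = p ∨ r = q) → IntegrableOn
      (fun z => chartPartition M q ((chartAt ℂ r).symm z) *
        flux (chartPartition M p ∘ (chartAt ℂ r).symm) (f ∘ (chartAt ℂ r).symm) z)
      (chartAt ℂ r).target := by
    rintro p q r (rfl | rfl)
    · exact integrableOn_mul_flux hf (hat r) (hsm r) (hsub r)
        (contDiffOn_comp_symm (hat r) (hsm q)).continuousOn
    · exact integrableOn_mul_of_tsupport_subset (hat r) (hsm r) (hsub r)
        (continuousOn_flux hf (hat r) (hsm p))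
  rw [surfaceIntegral_eq_sum hs0]
  simp only [smul_eq_mul]
  calc _ = ∑ p ∈ s, -∫ z in (chartAt ℂ p).target,
        flux (chartPartition M p ∘ (chartAt ℂ p).symm) (f ∘ (chartAt ℂ p).symm) z :=
        Finset.sum_congr rfl fun p _ => integral_mul_divVertical hf (hat p) (hsm p) (hsub p)
    -- Insertion of `1 = ∑ q, ρ_q` makes each term supported in two charts, so that it can be moved
    -- from the chart at `p` to the chart at `q`.
    _ = ∑ p ∈ s, -∑ q ∈ s, ∫ z in (chartAt ℂ p).target,
        chartPartition M q ((chartAt ℂ p).symm z) *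
          flux (chartPartition M p ∘ (chartAt ℂ p).symm) (f ∘ (chartAt ℂ p).symm) z := by
        refine Finset.sum_congr rfl fun p _ => ?_
        rw [← integral_finsetSum s fun q _ => hint p q p (Or.inl rfl)]
        simp only [← Finset.sum_mul, hs1, one_mul]
    _ = ∑ p ∈ s, -∑ q ∈ s, ∫ z in (chartAt ℂ q).target,
        chartPartition M q ((chartAt ℂ q).symm z) *
          flux (chartPartition M p ∘ (chartAt ℂ q).symm) (f ∘ (chartAt ℂ q).symm) z := by
        refine Finset.sum_congr rfl fun p _ => congrArg _ (Finset.sum_congr rfl fun q _ => ?_)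
        exact integral_mul_flux_eq hf (hat p) (hat q) (hsm p) (hsub p) (hsub q)
    _ = -∑ q ∈ s, ∑ p ∈ s, ∫ z in (chartAt ℂ q).target,
        chartPartition M q ((chartAt ℂ q).symm z) *
          flux (chartPartition M p ∘ (chartAt ℂ q).symm) (f ∘ (chartAt ℂ q).symm) z := by
        rw [Finset.sum_neg_distrib, Finset.sum_comm]
    _ = 0 := by
        rw [neg_eq_zero]
        -- In the fixed chart at `q` the flux is linear in the differential of the cutoff, and `∑ p,
        -- dρ_p = d1 = 0`.
        refine Finset.sum_eq_zero fun q _ => ?_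
        rw [← integral_finsetSum s fun p _ => hint p q q (Or.inr rfl)]
        refine setIntegral_eq_zero_of_forall_eq_zero fun z hz => ?_
        have hd : ∀ p, HasFDerivAt (chartPartition M p ∘ (chartAt ℂ q).symm) _ z := fun p =>
          (((contDiffOn_comp_symm (hat q) (hsm p)).contDiffAt
            ((chartAt ℂ q).open_target.mem_nhds hz)).differentiableAt (by simp)).hasFDerivAt
        have hsum := HasFDerivAt.fun_sum (u := s) fun p _ => hd p
        simp only [Function.comp_apply, hs1] at hsum
        have h1 := hsum.unique (hasFDerivAt_const (1 : ℝ) z)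
        have h2 : ∀ v, ∑ p ∈ s, fderiv ℝ (chartPartition M p ∘ (chartAt ℂ q).symm) z v = 0 :=
          fun v => by simpa using congrArg (fun l : ℂ →L[ℝ] ℝ => l v) h1
        simp only [flux, ← Finset.mul_sum, Finset.sum_add_distrib, ← Finset.sum_mul, h2,
          zero_mul, add_zero, mul_zero]

/-- In each chart the integrand is `energyDensity - (5/16) i divVertical`, and the second term
integrates to zero over `M`. -/
theorem energy_eq (hf : IsConformalImmersion f) : energy f =
    ((surfaceIntegral fun (e : OpenPartialHomeomorph M ℂ) z =>
      energyDensity (f ∘ e.symm) z : ℝ) : ℂ) := by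
  obtain ⟨s, hs0, -⟩ := exists_finset_chartPartition M
  have hsub := chartPartition_isSubordinate M
  have hsm : ∀ p : M, ContMDiff 𝓘(ℝ, ℂ) 𝓘(ℝ, ℝ) ∞ (chartPartition M p) :=
    fun p => (chartPartition M p).contMDiff
  have hdiv := surfaceIntegral_divVertical hf
  rw [surfaceIntegral_eq_sum hs0] at hdiv
  rw [energy, surfaceIntegral_eq_sum hs0, surfaceIntegral_eq_sum hs0]
  have hp : ∀ p : M, ∫ z in (chartAt ℂ p).target,
      chartPartition M p ((chartAt ℂ p).symm z) • ((diracPotentials f (chartAt ℂ p)).1 z *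
        (diracPotentials f (chartAt ℂ p)).2 z) =
      ((∫ z in (chartAt ℂ p).target, chartPartition M p ((chartAt ℂ p).symm z) •
        energyDensity (f ∘ (chartAt ℂ p).symm) z : ℝ) : ℂ) +
      (-(5 / 16) * Complex.I) * ((∫ z in (chartAt ℂ p).target,
        chartPartition M p ((chartAt ℂ p).symm z) •
          divVertical (f ∘ (chartAt ℂ p).symm) z : ℝ) : ℂ) := by
    intro p
    have he := chart_mem_atlas ℂ p
    have hF := hf.conformalOn he
    have hUV : IsDiracPotential (f ∘ (chartAt ℂ p).symm) (chartAt ℂ p).target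
        (diracPotentials f (chartAt ℂ p)).1 (diracPotentials f (chartAt ℂ p)).2 :=
      Classical.epsilon_spec (p := fun P : (ℂ → ℂ) × (ℂ → ℂ) =>
        IsDiracPotential (f ∘ (chartAt ℂ p).symm) (chartAt ℂ p).target P.1 P.2)
        ⟨(_, _), hF.isDiracPotential⟩
    -- `diracPotentials` is an arbitrary choice; uniqueness identifies it with the explicit
    -- potentials on the chart domain.
    obtain ⟨hU, hV⟩ := hF.isDiracPotential_unique hUV
    have i1 := integrableOn_mul_of_tsupport_subset he (hsm p) (hsub p)
      (continuousOn_energyDensity hf he)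
    have i2 := integrableOn_mul_of_tsupport_subset he (hsm p) (hsub p)
      (continuousOn_divVertical hf he)
    rw [← integral_complex_ofReal, ← integral_complex_ofReal, ← integral_const_mul,
      ← integral_add i1.ofReal (i2.ofReal.const_mul _)]
    refine setIntegral_congr_fun (chartAt ℂ p).open_target.measurableSet fun z hz => ?_
    simp only [hU hz, hV hz, hF.potential_mul hz, Complex.real_smul, smul_eq_mul]
    push_cast
    ring
  simp only [hp, Finset.sum_add_distrib, ← Finset.mul_sum, ← Complex.ofReal_sum, hdiv]
  simp

end Partition

end

theorem mainTheorem8 {M : Type*} [TopologicalSpace M] [T2Space M] [CompactSpace M]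
    [ChartedSpace ℂ M] [IsManifold 𝓘(ℂ) ω M] (f : M → SLTilde) (hf : IsConformalImmersion f) :
    (∀ e ∈ atlas ℂ M, ∃ U V : ℂ → ℂ,
      SLTilde.IsDiracPotential (f ∘ e.symm) e.target U V ∧
      ∀ U' V' : ℂ → ℂ, SLTilde.IsDiracPotential (f ∘ e.symm) e.target U' V' →
        Set.EqOn U' U e.target ∧ Set.EqOn V' V e.target) ∧
    (energy f).im = 0 ∧
    energy f = ((surfaceIntegral fun (e : OpenPartialHomeomorph M ℂ) (z : ℂ) =>
      SLTilde.meanCurvature (f ∘ e.symm) z ^ 2 / 4 *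
          (‖(SLTilde.spinor (f ∘ e.symm) z).1‖ ^ 2 + ‖(SLTilde.spinor (f ∘ e.symm) z).2‖ ^ 2) ^ 2 -
        (1 / 2 * ‖(SLTilde.spinor (f ∘ e.symm) z).1‖ ^ 2 -
            3 / 4 * ‖(SLTilde.spinor (f ∘ e.symm) z).2‖ ^ 2) *
          (3 / 4 * ‖(SLTilde.spinor (f ∘ e.symm) z).1‖ ^ 2 -
            1 / 2 * ‖(SLTilde.spinor (f ∘ e.symm) z).2‖ ^ 2) : ℝ) : ℂ) := by
  refine ⟨fun e he => ⟨_, _, (hf.conformalOn he).isDiracPotential,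
    fun U' V' h => (hf.conformalOn he).isDiracPotential_unique h⟩, ?_, ?_⟩
  · rw [energy_eq hf, Complex.ofReal_im]
  · rw [energy_eq hf]
    congr 1
    refine finsum_congr fun p => ?_
    refine MeasureTheory.setIntegral_congr_fun (chartAt ℂ p).open_target.measurableSet
      fun z hz => ?_
    -- The chosen spinor enters only through its squared moduli, which every generating spinor
    -- shares.
    have hψ := (hf.conformalOn (chart_mem_atlas ℂ p)).isSpinor_spinor hz
    simp only [SLTilde.energyDensity, hψ.norm_fst_sq, hψ.norm_snd_sq]
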